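/- \textbf{Setting.} Consider the one-dimensional Euler system for an ideal polytropic gas in Lagrangian coordinates, with states $(\tau,u,p)$ ($\tau,p>0$) and adiabatic constant $\gamma>1$. Put $a=\frac{\gamma-1}{\gamma+1}$, $\kappa=\sqrt{1-a}$, $\nu=\frac{\sqrt{1-a^2}}{a}$, $\zeta=\frac{a}{1+a}$. For $q>0$ let $\phi_-(q)=q^{-1/\gamma}$, $\psi_-(q)=\nu(q^\zeta-1)$ if $q\le 1$ and $\phi_-(q)=\frac{1+aq}{q+a}$, $\psi_-(q)=\frac{\kappa(q-1)}{\sqrt{q+a}}$ if $q>1$; let $\phi_+,\psi_+$ be given by the same formulas with the two cases $q\le1$, $q>1$ interchanged (at $q=1$ both formulas agree). The states that can be connected on the right to $(\tau,u,p)$ are $(\phi_-(b)\tau,\,u-\psi_-(b)\sqrt{\tau p},\,bp)$ by a backward wave of strength $b$ (rarefaction for $b<1$, shock for $b>1$), $(c\tau,u,p)$ by a contact of strength $c$, and $(\phi_+(f)\tau,\,u+\psi_+(f)\sqrt{\tau p},\,fp)$ by a forward wave of strength $f$ (shock for $f<1$, rarefaction for $f>1$). A left-most state, followed by a backward wave of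 strength $x$ and then a backward wave of strength $y$, determines a right-most state; the Riemann problem with these two extreme states is solved by an outgoing backward wave $B$, contact $C$ and forward (reflected) wave $F=F(x,y)$. If it has a vacuum, i.e. if $u_r-u_l\ge\frac{2}{\gamma-1}(\sqrt{\gamma\tau_rp_r}+\sqrt{\gamma\tau_lp_l})$, the outgoing waves are a backward rarefaction into the vacuum and a forward rarefaction out of it, and we set $B=0$, $F=+\infty$. The strengths $B,F$ are uniquely determined and all transition curves below depend only on $\gamma$, not on the left-most state. Let $\alpha(q)=\psi_+(q)-\psi_-(q)$ for $q>0$. \textbf{Proposition.} Let $\gamma>\frac53$ (i.e. $a>\frac14$), and put \[ j(x)=\frac{2a}{(1-a)^2x}\Big[a(1+x)+\sqrt{a^2(1+x)^2+ax(1-a)^2}\Big],\quad \bar x=\frac{4a^2}{1-3a},\quad \bar y=\frac{2a\sqrt a}{(1-\sqrt a)^2},\quad y_*=\frac{4a^2}{(1-a)^2}. \] (a) Shock--shock interactions ($x,y>1$) may yield either type of reflected wave. The function $j$ is strictly decreasing on $[1,\infty)$ and, in the region $x,y>1$, the set $\{F=1\}$ is the graph $y=j(x)$. It meets the line $x=1$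 at $(1,\bar y)$, $\bar y>1$. If $\frac53<\gamma<2$ it meets the line $y=1$ at $(\bar x,1)$, $\bar x>1$. If $\gamma\ge2$ it has the horizontal asymptote $y=y_*$ as $x\to\infty$, where $y_*>1$ if $\gamma>2$ and $y_*=1$ if $\gamma=2$. Moreover $F>1$ (rarefaction) if and only if $y>\max(j(x),1)$, and $F<1$ (shock) if and only if $1<y<j(x)$. (b) Shock--rarefaction interactions ($0<y<1<x$). If $\gamma\ge2$, the set $\{F=1\}$ does not meet this region and $F>1$ throughout. If $\frac53<\gamma<2$, then in this region $\{F=1\}$ is a graph $y=h(x)$, $x>\bar x$, with $0<h(x)<1$, where $h$ is continuous on $[\bar x,\infty)$ and $h(\bar x)=1$. Moreover $F>1$ if and only if $x\le\bar x$ or $y<h(x)$, and $F<1$ if and only if $x>\bar x$ and $h(x)<y<1$. For $x>1$ the set $\{B=1\}$ (in $y>0$) is a graph $y=k(x)$, and $h(x)>k(x)$ for all $x>\bar x$. (c) Rarefaction--shock interactions ($0<x<1<y$) may yield either type of reflected wave. The function $\alpha$ has exactly one zero $y_0$ in $(0,\infty)$ different from $1$, and $y_0>1$. In this region $\{F=1\}$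 is a graph $y=i(x)$, $0<x<1$, with $i(x)>1$; $F>1$ if and only if $y<i(x)$, and $F<1$ if and only if $y>i(x)$. Moreover $i(x)=y_0$ for $0<x<\frac1{y_0}$, and $\frac1x<i(x)<\min\{\frac{\bar y}{x},y_0\}$ for $\frac1{y_0}<x<1$. -/

import Mathlib

open Set Filter Topology

namespace GasDynamics

noncomputable section

/-- A state of the gas: specific volume `τ`, velocity `u`, pressure `p`. -/
structure GasState where
  τ : ℝ
  u : ℝ
  p : ℝ

/-- Physical (non-vacuum) states. -/
def GasState.Physical (s : GasState) : Prop := 0 < s.τ ∧ 0 < s.p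

/-- The parameter `a = (γ - 1) / (γ + 1)`. -/
def aPar (γ : ℝ) : ℝ := (γ - 1) / (γ + 1)

def kappa (γ : ℝ) : ℝ := √(1 - aPar γ)

def nu (γ : ℝ) : ℝ := √(1 - aPar γ ^ 2) / aPar γ

def zeta (γ : ℝ) : ℝ := aPar γ / (1 + aPar γ)

/-- Specific volume ratio across a backward wave of strength (pressure ratio) `b`:
rarefaction for `b < 1`, shock for `b > 1`. -/
def phiB (γ b : ℝ) : ℝ :=
  if b ≤ 1 then b ^ (-(1 / γ)) else (1 + aPar γ * b) / (b + aPar γ)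

def psiB (γ b : ℝ) : ℝ :=
  if b ≤ 1 then nu γ * (b ^ zeta γ - 1) else kappa γ * (b - 1) / √(b + aPar γ)

/-- Specific volume ratio across a forward wave of strength (pressure ratio) `f`:
shock for `f < 1`, rarefaction for `f > 1`. -/
def phiF (γ f : ℝ) : ℝ :=
  if 1 ≤ f then f ^ (-(1 / γ)) else (1 + aPar γ * f) / (f + aPar γ)

def psiF (γ f : ℝ) : ℝ :=
  if 1 ≤ f then nu γ * (f ^ zeta γ - 1) else kappa γ * (f - 1) / √(f + aPar γ)

/-- The state to the right of a backward wave of strength `b` whose left state is `s`. -/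
def backwardWave (γ b : ℝ) (s : GasState) : GasState where
  τ := phiB γ b * s.τ
  u := s.u - psiB γ b * √(s.τ * s.p)
  p := b * s.p

/-- The state to the right of a contact of strength (specific volume ratio) `c`
whose left state is `s`. -/
def contactWave (c : ℝ) (s : GasState) : GasState where
  τ := c * s.τ
  u := s.u
  p := s.p

/-- The state to the right of a forward wave of strength `f` whose left state is `s`. -/
def forwardWave (γ f : ℝ) (s : GasState) : GasState where
  τ := phiF γ f * s.τ
  u := s.u + psiF γ f * √(s.τ * s.p)
  p := f * s.p

def soundSpeed (γ : ℝ) (s : GasState) : ℝ := √(γ * s.τ * s.p)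

/-- The Riemann problem with left state `l` and right state `r` is solved without vacuum by a
backward wave `B`, a contact `C` and a forward wave `F`. -/
def SolvesRiemann (γ : ℝ) (l r : GasState) (B C F : ℝ) : Prop :=
  0 < B ∧ 0 < C ∧ 0 < F ∧ forwardWave γ F (contactWave C (backwardWave γ B l)) = r

/-- The solution of the Riemann problem contains a vacuum. -/
def HasVacuum (γ : ℝ) (l r : GasState) : Prop :=
  2 / (γ - 1) * (soundSpeed γ r + soundSpeed γ l) ≤ r.u - l.u

/-- `(B, F)` are the strengths of the outgoing backward and forward waves in the solution of the
Riemann problem `(l, r)`. If there is a vacuum, the outgoing waves are a backward rarefaction from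
`l` to the vacuum (pressure ratio `0 / l.p = 0`) and a forward rarefaction from the vacuum to `r`
(pressure ratio `r.p / 0 = ∞`). -/
def IsOutgoing (γ : ℝ) (l r : GasState) (P : EReal × EReal) : Prop :=
  (∃ B C F : ℝ, SolvesRiemann γ l r B C F ∧ P = ((B : EReal), (F : EReal))) ∨
    (HasVacuum γ l r ∧ P = (0, ⊤))

/-- The right-most state in the interaction of two overtaking backward waves, the left one of
strength `x` and the right one of strength `y`, with left-most state `l`. -/
def overtakingRight (γ x y : ℝ) (l : GasState) : GasState :=
  backwardWave γ y (backwardWave γ x l)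

/-- The pair of outgoing strengths (backward, forward) in the interaction of two overtaking
backward waves of strengths `x` (left) and `y` (right) with left-most state `l`. -/
def outgoingPair (γ : ℝ) (l : GasState) (x y : ℝ) : EReal × EReal :=
  Classical.epsilon (IsOutgoing γ l (overtakingRight γ x y l))

/-- Strength of the transmitted (outgoing backward) wave. -/
def transmitted (γ : ℝ) (l : GasState) (x y : ℝ) : EReal := (outgoingPair γ l x y).1

/-- Strength of the reflected (outgoing forward) wave: a rarefaction if it is `> 1`,
a shock if it is `< 1`, absent if it is `1`. -/
def reflected (γ : ℝ) (l : GasState) (x y : ℝ) : EReal := (outgoingPair γ l x y).2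

def alpha (γ q : ℝ) : ℝ := psiF γ q - psiB γ q

def jCurve (γ x : ℝ) : ℝ :=
  2 * aPar γ / ((1 - aPar γ) ^ 2 * x) *
    (aPar γ * (1 + x) + √(aPar γ ^ 2 * (1 + x) ^ 2 + aPar γ * x * (1 - aPar γ) ^ 2))

def xBar (γ : ℝ) : ℝ := 4 * aPar γ ^ 2 / (1 - 3 * aPar γ)

def yBar (γ : ℝ) : ℝ := 2 * aPar γ * √(aPar γ) / (1 - √(aPar γ)) ^ 2

def yStar (γ : ℝ) : ℝ := 4 * aPar γ ^ 2 / (1 - aPar γ) ^ 2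

end

end GasDynamics

open GasDynamics

/-!
Write `ψ = psiB γ`, `s(x) = √(x φ(x))` for the ratio of `√(τ p)` across a backward wave
(`impRatio`), and `ν`, `ζ`, `a` as in the definitions.

*Reduction.* A forward wave is a backward wave read from right to left (`psiF_eq`). So the outgoing
backward strength `B` is the zero of a strictly increasing function, the velocity defect
(`riemannDefect`), and this zero fails to exist exactly if there is a vacuum
(`existsUnique_isOutgoing`). Since `F = x y / B`, the sign of the defect at `B = x y` decides
whether `F` is larger or smaller than `1`: the reflected wave is a rarefaction, absent or a shock
according to the sign of `reflDefect`, `D(x, y) = ψ(x y) - ψ(x) - ψ(y) s(x)`. Likewise `B = 1`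
amounts to the vanishing of `transDefect`. With a vacuum the defect is positive everywhere, which
agrees with `F = ∞`, `B = 0`.

*Two shocks.* Clearing the square roots by two conjugates turns the sign of `D` into the sign of a
quadratic polynomial in `y` whose positive root is `jCurve γ x`.

*Waves of different type.* Put `M(q) = q ^ (1 - ζ) ψ'(q)` (`waveSlope`). Then
`∂D/∂y = y ^ (ζ - 1) (x ^ ζ M(x y) - s(x) M(y))`. The function `M` is constant on `(0, 1]`,
decreases on `[1, slopeMin γ]` and increases from there on; that `slopeMin γ > 1` is the
condition `a > 1 / 4`. This shape and `s(x) = x ^ ζ` for `x ≤ 1`, `s(x) > x ^ ζ` for `x > 1`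
show that `∂D/∂y` changes sign at most once in `y > 1` if `x < 1`, and in `y < 1` if `x > 1`. As
`D(x, 1) = 0`, so does `D` (`exists_sign_change`), which gives the curves `i` and `h`. For a shock
followed by a rarefaction, whether there is a change is decided by `∂D/∂y` at `y = 1`, which has
the sign of `(1 - 3 a) x - 4 a ^ 2`. The location of `i` follows from the sign of `D` at `y = 1 / x`,
`y = y₀` and `y = yBar γ / x`; in the first two cases `D` reduces to `alpha`. The curve `k` comes
from the monotonicity of `(ψ(q) - ν) / q ^ ζ`, and it stays below `h` because there `F = 1`
entails `B = x h(x) > 1`.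
-/

open GasDynamics

namespace GasDynamics

variable {γ : ℝ}

/-! ### Parameters -/

lemma aPar_pos (hγ : 1 < γ) : 0 < aPar γ := div_pos (by linarith) (by linarith)

lemma aPar_lt_one (hγ : 1 < γ) : aPar γ < 1 := by
  rw [aPar, div_lt_one (by linarith)]; linarith

lemma quarter_lt_aPar (hγ : 5 / 3 < γ) : 1 / 4 < aPar γ := by
  rw [aPar, lt_div_iff₀ (by linarith)]; linarith

lemma aPar_lt_third (hγ : 1 < γ) (h : γ < 2) : 3 * aPar γ < 1 := by
  rw [aPar, ← mul_div_assoc, div_lt_one (by linarith)]; linarith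

lemma third_le_aPar (h : 2 ≤ γ) : 1 ≤ 3 * aPar γ := by
  rw [aPar, ← mul_div_assoc, le_div_iff₀ (by linarith)]; linarith

lemma zeta_pos (hγ : 1 < γ) : 0 < zeta γ :=
  div_pos (aPar_pos hγ) (by linarith [aPar_pos hγ])

lemma zeta_lt_half (hγ : 1 < γ) : zeta γ < 1 / 2 := by
  have := aPar_pos hγ
  have := aPar_lt_one hγ
  rw [zeta, div_lt_iff₀ (by linarith)]; linarith

lemma one_div_gamma (hγ : 1 < γ) : 1 / γ = 1 - 2 * zeta γ := by
  have h1 : γ + 1 ≠ 0 := by linarith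
  have h2 : γ ≠ 0 := by linarith
  have : 1 + (γ - 1) / (γ + 1) = 2 * γ / (γ + 1) := by field_simp; ring
  rw [zeta, aPar, this]
  field_simp
  ring

lemma kappa_pos (hγ : 1 < γ) : 0 < kappa γ := Real.sqrt_pos.2 (by linarith [aPar_lt_one hγ])

lemma nu_mul_aPar (hγ : 1 < γ) : nu γ * aPar γ = kappa γ * √(1 + aPar γ) := by
  have h0 := aPar_pos hγ
  have h1 := aPar_lt_one hγ
  rw [nu, kappa, div_mul_cancel₀ _ h0.ne', ← Real.sqrt_mul (by linarith)]
  congr 1; ring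

lemma nu_pos (hγ : 1 < γ) : 0 < nu γ := by
  have h0 := aPar_pos hγ
  have h1 := aPar_lt_one hγ
  exact div_pos (Real.sqrt_pos.2 (by nlinarith)) h0

lemma nu_mul_zeta (hγ : 1 < γ) : nu γ * zeta γ = kappa γ / √(1 + aPar γ) := by
  have h0 := aPar_pos hγ
  have hs : √(1 + aPar γ) ≠ 0 := (Real.sqrt_pos.2 (by linarith)).ne'
  have hsq : √(1 + aPar γ) ^ 2 = 1 + aPar γ := Real.sq_sqrt (by linarith)
  rw [zeta, ← mul_div_assoc, nu_mul_aPar hγ]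
  field_simp
  rw [hsq]

/-! ### The wave curve of the velocity -/

/-- The shock branch of `psiB` and `psiF`, as a function on all of `(0, ∞)`. -/
noncomputable def shockPsi (γ q : ℝ) : ℝ := kappa γ * (q - 1) / √(q + aPar γ)

/-- `q ^ (1 - ζ)` times the derivative of the shock branch. -/
noncomputable def shockSlope (γ q : ℝ) : ℝ :=
  q ^ (1 - zeta γ) * (kappa γ * (q + 1 + 2 * aPar γ) / (2 * √(q + aPar γ) ^ 3))

/-- `q ^ (1 - ζ)` times the derivative of `psiB`: constant on the rarefaction branch. -/
noncomputable def waveSlope (γ q : ℝ) : ℝ :=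
  if q ≤ 1 then nu γ * zeta γ else shockSlope γ q

/-- The ratio of `√(τ p)` across a backward wave of strength `q`. -/
noncomputable def impRatio (γ q : ℝ) : ℝ := √(q * phiB γ q)

lemma psiB_of_le {q : ℝ} (h : q ≤ 1) : psiB γ q = nu γ * (q ^ zeta γ - 1) := if_pos h

lemma psiB_of_ge {q : ℝ} (h : 1 ≤ q) : psiB γ q = shockPsi γ q := by
  rcases h.eq_or_lt with rfl | h
  · simp [psiB, shockPsi]
  · exact if_neg h.not_ge

lemma psiF_of_le {q : ℝ} (h : q ≤ 1) : psiF γ q = shockPsi γ q := by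
  rcases h.eq_or_lt with rfl | h
  · simp [psiF, shockPsi]
  · exact if_neg h.not_ge

lemma psiF_of_ge {q : ℝ} (h : 1 ≤ q) : psiF γ q = nu γ * (q ^ zeta γ - 1) := if_pos h

@[simp] lemma psiB_one : psiB γ 1 = 0 := by simp [psiB]

lemma psiB_nonneg (hγ : 1 < γ) {q : ℝ} (h : 1 ≤ q) : 0 ≤ psiB γ q := by
  rw [psiB_of_ge h]
  exact div_nonneg (mul_nonneg (kappa_pos hγ).le (by linarith)) (Real.sqrt_nonneg _)

lemma psiB_pos (hγ : 1 < γ) {q : ℝ} (h : 1 < q) : 0 < psiB γ q := by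
  rw [psiB_of_ge h.le]
  have := aPar_pos hγ
  exact div_pos (mul_pos (kappa_pos hγ) (by linarith)) (Real.sqrt_pos.2 (by linarith))

lemma psiB_neg (hγ : 1 < γ) {q : ℝ} (h0 : 0 < q) (h : q < 1) : psiB γ q < 0 := by
  rw [psiB_of_le h.le]
  exact mul_neg_of_pos_of_neg (nu_pos hγ)
    (by linarith [Real.rpow_lt_one h0.le h (zeta_pos hγ)])

lemma shockSlope_one (hγ : 1 < γ) : shockSlope γ 1 = nu γ * zeta γ := by
  have h0 := aPar_pos hγ
  have hs : √(1 + aPar γ) ≠ 0 := (Real.sqrt_pos.2 (by linarith)).ne'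
  have hsq : √(1 + aPar γ) ^ 2 = 1 + aPar γ := Real.sq_sqrt (by linarith)
  rw [nu_mul_zeta hγ, shockSlope, Real.one_rpow, one_mul,
    show 1 + 1 + 2 * aPar γ = 2 * √(1 + aPar γ) ^ 2 by rw [hsq]; ring]
  field_simp

lemma waveSlope_of_le {q : ℝ} (h : q ≤ 1) : waveSlope γ q = nu γ * zeta γ := if_pos h

lemma waveSlope_of_ge (hγ : 1 < γ) {q : ℝ} (h : 1 ≤ q) : waveSlope γ q = shockSlope γ q := by
  rcases h.eq_or_lt with rfl | h
  · rw [shockSlope_one hγ, waveSlope_of_le le_rfl]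
  · exact if_neg h.not_ge

lemma shockSlope_pos (hγ : 1 < γ) {q : ℝ} (h : 0 < q) : 0 < shockSlope γ q := by
  have h0 := aPar_pos hγ
  have := kappa_pos hγ
  have : 0 < √(q + aPar γ) := Real.sqrt_pos.2 (by linarith)
  unfold shockSlope
  positivity

lemma waveSlope_pos (hγ : 1 < γ) {q : ℝ} (h : 0 < q) : 0 < waveSlope γ q := by
  unfold waveSlope
  split_ifs
  · exact mul_pos (nu_pos hγ) (zeta_pos hγ)
  · exact shockSlope_pos hγ h

lemma hasDerivAt_shockPsi (hγ : 1 < γ) {q : ℝ} (h : 0 < q) :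
    HasDerivAt (shockPsi γ) (q ^ (zeta γ - 1) * shockSlope γ q) q := by
  have h0 := aPar_pos hγ
  have hp : 0 < q + aPar γ := by linarith
  have hs : √(q + aPar γ) ≠ 0 := (Real.sqrt_pos.2 hp).ne'
  have hsq : √(q + aPar γ) ^ 2 = q + aPar γ := Real.sq_sqrt hp.le
  have d1 : HasDerivAt (fun q : ℝ => √(q + aPar γ)) (1 / (2 * √(q + aPar γ))) q :=
    ((hasDerivAt_id q).add_const (aPar γ)).sqrt hp.ne'
  have d2 : HasDerivAt (fun q : ℝ => kappa γ * (q - 1)) (kappa γ * 1) q :=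
    ((hasDerivAt_id q).sub_const 1).const_mul (kappa γ)
  refine (d2.div d1 hs).congr_deriv ?_
  symm
  rw [shockSlope, ← mul_assoc, ← Real.rpow_add h]
  simp only [sub_add_sub_cancel, sub_self, Real.rpow_zero, one_mul]
  have h3 : √(q + aPar γ) ^ 3 = √(q + aPar γ) * (q + aPar γ) := by rw [pow_succ', hsq]
  rw [hsq, h3]
  field_simp
  rw [hsq]
  ring

lemma hasDerivAt_psiB (hγ : 1 < γ) {q : ℝ} (h : 0 < q) :
    HasDerivAt (psiB γ) (q ^ (zeta γ - 1) * waveSlope γ q) q := by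
  have hr : HasDerivAt (fun q : ℝ => nu γ * (q ^ zeta γ - 1))
      (q ^ (zeta γ - 1) * (nu γ * zeta γ)) q := by
    refine (((Real.hasDerivAt_rpow_const (p := zeta γ) (Or.inl h.ne')).sub_const 1).const_mul
      (nu γ)).congr_deriv ?_
    ring
  have hl : q ≤ 1 → HasDerivWithinAt (psiB γ) (q ^ (zeta γ - 1) * waveSlope γ q) (Iic 1) q := by
    intro hq
    rw [waveSlope_of_le hq]
    exact hr.hasDerivWithinAt.congr (fun z hz => psiB_of_le hz) (psiB_of_le hq)
  have hu : 1 ≤ q → HasDerivWithinAt (psiB γ) (q ^ (zeta γ - 1) * waveSlope γ q) (Ici 1) q := by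
    intro hq
    rw [waveSlope_of_ge hγ hq]
    exact (hasDerivAt_shockPsi hγ h).hasDerivWithinAt.congr (fun z hz => psiB_of_ge hz)
      (psiB_of_ge hq)
  rcases lt_trichotomy q 1 with hq | rfl | hq
  · exact (hl hq.le).hasDerivAt (Iic_mem_nhds hq)
  · have := (hl le_rfl).union (hu le_rfl)
    rwa [Iic_union_Ici, hasDerivWithinAt_univ] at this
  · exact (hu hq.le).hasDerivAt (Ici_mem_nhds hq)

lemma continuousOn_psiB (hγ : 1 < γ) : ContinuousOn (psiB γ) (Ioi 0) :=
  fun _ hq => (hasDerivAt_psiB hγ hq).continuousAt.continuousWithinAt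

/-- A function on `(0, ∞)` with positive derivative is strictly increasing. -/
lemma strictMonoOn_Ioi_of_hasDerivAt {f f' : ℝ → ℝ} {c : ℝ}
    (hf : ∀ q, c < q → HasDerivAt f (f' q) q) (h : ∀ q, c < q → 0 < f' q) :
    StrictMonoOn f (Ioi c) := by
  refine strictMonoOn_of_deriv_pos (convex_Ioi c)
    (fun q hq => (hf q hq).continuousAt.continuousWithinAt) fun q hq => ?_
  rw [interior_Ioi] at hq
  rw [(hf q hq).deriv]
  exact h q hq

lemma strictMonoOn_psiB (hγ : 1 < γ) : StrictMonoOn (psiB γ) (Ioi 0) :=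
  strictMonoOn_Ioi_of_hasDerivAt (fun _ hq => hasDerivAt_psiB hγ hq)
    fun _ hq => mul_pos (Real.rpow_pos_of_pos hq _) (waveSlope_pos hγ hq)

lemma neg_nu_lt_psiB (hγ : 1 < γ) {q : ℝ} (h : 0 < q) : -nu γ < psiB γ q := by
  have := nu_pos hγ
  rcases le_total q 1 with hq | hq
  · rw [psiB_of_le hq]
    have := Real.rpow_pos_of_pos h (zeta γ)
    nlinarith
  · linarith [psiB_nonneg hγ hq]

/-- The second critical point of `shockSlope γ`, besides `1`. -/
noncomputable def slopeMin (γ : ℝ) : ℝ := (2 * aPar γ + 4 * aPar γ ^ 2) / (1 - aPar γ)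

lemma one_lt_slopeMin (hγ : 5 / 3 < γ) : 1 < slopeMin γ := by
  have h1 := aPar_lt_one (γ := γ) (by linarith)
  have h4 := quarter_lt_aPar hγ
  rw [slopeMin, lt_div_iff₀ (by linarith)]
  nlinarith

/-- One critical point of `shockSlope γ` is `1`, where shock and rarefaction branch have a contact
of second order; the other one is `slopeMin γ`. -/
lemma hasDerivAt_shockSlope (hγ : 1 < γ) {q : ℝ} (h : 0 < q) :
    HasDerivAt (shockSlope γ) (kappa γ * (1 - aPar γ) / (1 + aPar γ) * q ^ (-zeta γ) *
      ((q - 1) * (q - slopeMin γ)) / (4 * √(q + aPar γ) ^ 5)) q := by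
  have h0 := aPar_pos hγ
  have h1 := aPar_lt_one hγ
  have hp : 0 < q + aPar γ := by linarith
  have hs : √(q + aPar γ) ≠ 0 := (Real.sqrt_pos.2 hp).ne'
  have hsq : √(q + aPar γ) ^ 2 = q + aPar γ := Real.sq_sqrt hp.le
  have d1 : HasDerivAt (fun q : ℝ => √(q + aPar γ)) (1 / (2 * √(q + aPar γ))) q :=
    ((hasDerivAt_id q).add_const (aPar γ)).sqrt hp.ne'
  have d2 : HasDerivAt (fun q : ℝ => kappa γ * (q + 1 + 2 * aPar γ)) (kappa γ * 1) q :=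
    (((hasDerivAt_id q).add_const 1).add_const (2 * aPar γ)).const_mul (kappa γ)
  have d3 := (d1.pow 3).const_mul 2
  have d4 : HasDerivAt (fun q : ℝ => q ^ (1 - zeta γ)) _ q :=
    Real.hasDerivAt_rpow_const (p := 1 - zeta γ) (Or.inl h.ne')
  refine (d4.mul (d2.div d3 (mul_ne_zero two_ne_zero (pow_ne_zero 3 hs)))).congr_deriv ?_
  have e1 : q ^ (1 - zeta γ) = q ^ (-zeta γ) * q := by
    rw [sub_eq_neg_add, Real.rpow_add_one h.ne']
  have e2 : 1 - zeta γ - 1 = -zeta γ := by ring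
  simp only [Pi.pow_apply, Pi.div_apply, Nat.cast_ofNat, Nat.reduceSub]
  rw [e1, e2, slopeMin, zeta]
  set r := q ^ (-(aPar γ / (1 + aPar γ)))
  set t := √(q + aPar γ)
  have hq : q = t ^ 2 - aPar γ := by linarith
  have ha1 : 1 - aPar γ ≠ 0 := by linarith
  have ha2 : 1 + aPar γ ≠ 0 := by linarith
  clear_value t r
  subst hq
  field_simp
  ring

/-! ### Monotonicity of the wave slope -/

lemma slopeFactor_pos (hγ : 1 < γ) {q : ℝ} (h : 0 < q) :
    0 < kappa γ * (1 - aPar γ) / (1 + aPar γ) * q ^ (-zeta γ) / (4 * √(q + aPar γ) ^ 5) := by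
  have h0 := aPar_pos hγ
  have h1 : 0 < 1 - aPar γ := by linarith [aPar_lt_one hγ]
  have := kappa_pos hγ
  have : 0 < √(q + aPar γ) := Real.sqrt_pos.2 (by linarith)
  have := Real.rpow_pos_of_pos h (-zeta γ)
  positivity

lemma strictAntiOn_shockSlope (hγ : 1 < γ) :
    StrictAntiOn (shockSlope γ) (Icc 1 (slopeMin γ)) := by
  refine strictAntiOn_of_deriv_neg (convex_Icc _ _) (fun q hq =>
    (hasDerivAt_shockSlope hγ (zero_lt_one.trans_le hq.1)).continuousAt.continuousWithinAt)
    fun q hq => ?_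
  rw [interior_Icc] at hq
  have hq0 : 0 < q := zero_lt_one.trans hq.1
  rw [(hasDerivAt_shockSlope hγ hq0).deriv, mul_div_right_comm]
  exact mul_neg_of_pos_of_neg (slopeFactor_pos hγ hq0)
    (mul_neg_of_pos_of_neg (by linarith [hq.1]) (by linarith [hq.2]))

lemma strictMonoOn_shockSlope (hγ : 5 / 3 < γ) :
    StrictMonoOn (shockSlope γ) (Ici (slopeMin γ)) := by
  have hγ' : 1 < γ := by linarith
  have hm := one_lt_slopeMin hγ
  refine strictMonoOn_of_deriv_pos (convex_Ici _) (fun q hq =>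
    (hasDerivAt_shockSlope hγ' (by linarith [mem_Ici.1 hq])).continuousAt.continuousWithinAt)
    fun q hq => ?_
  rw [interior_Ici, mem_Ioi] at hq
  rw [(hasDerivAt_shockSlope hγ' (by linarith)).deriv, mul_div_right_comm]
  exact mul_pos (slopeFactor_pos hγ' (by linarith)) (mul_pos (by linarith) (by linarith))

/-- Below strength `1` the shock branch lies strictly below the tangency slope. -/
lemma shockSlope_lt_of_lt_one (hγ : 5 / 3 < γ) {q : ℝ} (h : 0 < q) (hq : q < 1) :
    shockSlope γ q < nu γ * zeta γ := by
  have hγ' : 1 < γ := by linarith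
  have hm := one_lt_slopeMin hγ
  have : StrictMonoOn (shockSlope γ) (Ioc 0 1) := by
    refine strictMonoOn_of_deriv_pos (convex_Ioc _ _) (fun q hq =>
      (hasDerivAt_shockSlope hγ' hq.1).continuousAt.continuousWithinAt) fun q hq => ?_
    rw [interior_Ioc] at hq
    rw [(hasDerivAt_shockSlope hγ' hq.1).deriv, mul_div_right_comm]
    exact mul_pos (slopeFactor_pos hγ' hq.1)
      (mul_pos_of_neg_of_neg (by linarith [hq.2]) (by linarith [hq.2]))
  rw [← shockSlope_one hγ']
  exact this ⟨h, hq.le⟩ ⟨one_pos, le_rfl⟩ hq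

/-- `waveSlope γ` is constant up to `1` and strictly decreasing from `1` to `slopeMin γ`. -/
lemma waveSlope_lt_of_lt (hγ : 1 < γ) {p q : ℝ} (hpq : p < q) (h1 : 1 < q)
    (hq : q ≤ slopeMin γ) : waveSlope γ q < waveSlope γ p := by
  rw [waveSlope_of_ge hγ h1.le]
  rcases le_total p 1 with hp | hp
  · rw [waveSlope_of_le hp, ← shockSlope_one hγ]
    exact strictAntiOn_shockSlope hγ ⟨le_rfl, h1.le.trans hq⟩ ⟨h1.le, hq⟩ h1
  · rw [waveSlope_of_ge hγ hp]
    exact strictAntiOn_shockSlope hγ ⟨hp, hpq.le.trans hq⟩ ⟨h1.le, hq⟩ hpq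

lemma waveSlope_le_of_le (hγ : 1 < γ) {p q : ℝ} (hpq : p ≤ q)
    (hq : q ≤ slopeMin γ) : waveSlope γ q ≤ waveSlope γ p := by
  rcases hpq.eq_or_lt with rfl | hpq
  · rfl
  rcases le_or_gt q 1 with h1 | h1
  · rw [waveSlope_of_le h1, waveSlope_of_le (hpq.le.trans h1)]
  · exact (waveSlope_lt_of_lt hγ hpq h1 hq).le

lemma waveSlope_lt_of_slopeMin_le (hγ : 5 / 3 < γ) {p q : ℝ} (hp : slopeMin γ ≤ p)
    (hpq : p < q) : waveSlope γ p < waveSlope γ q := by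
  have hm := one_lt_slopeMin hγ
  rw [waveSlope_of_ge (by linarith) (by linarith), waveSlope_of_ge (by linarith) (by linarith)]
  exact strictMonoOn_shockSlope hγ hp (hp.trans hpq.le) hpq

/-- Once a value of `waveSlope γ` is at least one attained at a smaller strength
(above strength `1`), the function increases from there on. -/
lemma slopeMin_lt_of_waveSlope_le (hγ : 1 < γ) {p q : ℝ} (hpq : p < q) (h1 : 1 < q)
    (h : waveSlope γ p ≤ waveSlope γ q) : slopeMin γ < q := by
  by_contra! hq
  exact (waveSlope_lt_of_lt hγ hpq h1 hq).not_ge h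

/-! ### Functions with one sign change -/

/-- If `f` vanishes at `c` and its derivative changes sign once, from `+` to `-`, and `f` is
negative somewhere, then `f` changes sign exactly once beyond `c`. -/
lemma exists_sign_change {f w g : ℝ → ℝ} {c : ℝ} (hcont : ContinuousOn f (Ici c))
    (hd : ∀ y, c < y → HasDerivAt f (w y * g y) y) (hw : ∀ y, c < y → 0 < w y)
    (hg : ∀ y, c < y → g y ≤ 0 → ∀ z, y < z → g z < 0) (hpos : ∃ y, c < y ∧ 0 < g y)
    (hc : f c = 0) (hneg : ∃ y, c < y ∧ f y < 0) :
    ∃ z, c < z ∧ f z = 0 ∧ (∀ y, c < y → y < z → 0 < f y) ∧ ∀ y, z < y → f y < 0 := by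
  have key : ∀ y, c < y → f y ≤ 0 → ∀ z, y < z → f z < 0 := by
    intro y hy hfy z hz
    obtain ⟨ξ, hξ, he⟩ := exists_hasDerivAt_eq_slope f (fun y => w y * g y) hy
      (hcont.mono Icc_subset_Ici_self) (fun t ht => hd t ht.1)
    have hgξ : g ξ ≤ 0 := by
      have h1 : w ξ * g ξ ≤ 0 := by
        rw [he, hc]
        exact div_nonpos_of_nonpos_of_nonneg (by linarith) (by linarith)
      by_contra! h2
      exact (mul_pos (hw ξ hξ.1) h2).not_ge h1
    have hanti : StrictAntiOn f (Ici ξ) := by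
      refine strictAntiOn_of_deriv_neg (convex_Ici _)
        (hcont.mono (Ici_subset_Ici.2 hξ.1.le)) fun t ht => ?_
      rw [interior_Ici, mem_Ioi] at ht
      have hct : c < t := hξ.1.trans ht
      rw [(hd t hct).deriv]
      exact mul_neg_of_pos_of_neg (hw t hct) (hg ξ hξ.1 hgξ t ht)
    exact (hanti hξ.2.le (hξ.2.le.trans hz.le) hz).trans_le hfy
  obtain ⟨y₁, hy₁, hgy₁⟩ := hpos
  obtain ⟨y₂, hy₂, hfy₂⟩ := hneg
  have hfy₁ : 0 < f y₁ := by
    obtain ⟨ξ, hξ, he⟩ := exists_hasDerivAt_eq_slope f (fun y => w y * g y) hy₁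
      (hcont.mono Icc_subset_Ici_self) (fun t ht => hd t ht.1)
    have hgξ : 0 < g ξ := by
      by_contra! h
      exact (hg ξ hξ.1 h y₁ hξ.2).not_gt hgy₁
    have h2 := mul_pos (hw ξ hξ.1) hgξ
    rw [he, hc, sub_zero] at h2
    exact (div_pos_iff_of_pos_right (by linarith)).1 h2
  have h12 : y₁ < y₂ := by
    by_contra! h
    rcases h.eq_or_lt with rfl | h
    · linarith
    · linarith [key y₂ hy₂ hfy₂.le y₁ h]
  obtain ⟨z, hz, hfz⟩ := intermediate_value_Icc' h12.le
    (hcont.mono (Icc_subset_Ici_self.trans (Ici_subset_Ici.2 hy₁.le))) ⟨hfy₂.le, hfy₁.le⟩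
  have hcz : c < z := hy₁.trans_le hz.1
  refine ⟨z, hcz, hfz, fun y hy hyz => ?_, fun y hy => key z hcz hfz.le y hy⟩
  by_contra! h
  exact (key y hy h z hyz).ne hfz

/-- A function that is positive before its zero `z` and negative after it. -/
lemma sign_change_iff {f : ℝ → ℝ} {y z : ℝ} (h0 : f z = 0) (hpos : y < z → 0 < f y)
    (hneg : z < y → f y < 0) :
    (f y = 0 ↔ y = z) ∧ (0 < f y ↔ y < z) ∧ (f y < 0 ↔ z < y) := by
  rcases lt_trichotomy y z with h | rfl | h
  · have := hpos h
    exact ⟨iff_of_false this.ne' h.ne, iff_of_true this h, iff_of_false this.not_gt h.not_gt⟩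
  · simp [h0]
  · have := hneg h
    exact ⟨iff_of_false this.ne h.ne', iff_of_false this.not_gt h.not_gt, iff_of_true this h⟩

/-! ### Growth of the wave curve -/

lemma psiB_le_sqrt (hγ : 1 < γ) {q : ℝ} (h : 0 < q) : psiB γ q ≤ kappa γ * √q := by
  have h0 := aPar_pos hγ
  have hk := kappa_pos hγ
  rcases le_total q 1 with hq | hq
  · have h1 : psiB γ q ≤ 0 := by
      rcases hq.eq_or_lt with rfl | hq
      · simp
      · exact (psiB_neg hγ h hq).le
    exact h1.trans (by positivity)
  · rw [psiB_of_ge hq, shockPsi, mul_div_assoc]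
    refine mul_le_mul_of_nonneg_left ?_ hk.le
    rw [div_le_iff₀ (Real.sqrt_pos.2 (by linarith))]
    have h2 : √q ≤ √(q + aPar γ) := Real.sqrt_le_sqrt (by linarith)
    have h3 := Real.mul_self_sqrt h.le
    nlinarith [Real.sqrt_nonneg q]

lemma sqrt_sub_le_psiB (hγ : 1 < γ) {q : ℝ} (h : 1 ≤ q) : kappa γ * (√q - 2) ≤ psiB γ q := by
  have h0 := aPar_pos hγ
  have h1 := aPar_lt_one hγ
  rw [psiB_of_ge h, shockPsi, mul_div_assoc]
  refine mul_le_mul_of_nonneg_left ?_ (kappa_pos hγ).le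
  rw [le_div_iff₀ (Real.sqrt_pos.2 (by linarith))]
  have h3 := Real.mul_self_sqrt (show 0 ≤ q by linarith)
  have h4 : 1 ≤ √q := Real.one_le_sqrt.2 h
  have h5 : √(q + aPar γ) ≤ √q + 1 := by
    rw [Real.sqrt_le_left (by linarith)]; nlinarith
  have h6 : 0 ≤ √(q + aPar γ) := Real.sqrt_nonneg _
  have h7 : √q ≤ √(q + aPar γ) := Real.sqrt_le_sqrt (by linarith)
  nlinarith

lemma tendsto_psiB_atTop (hγ : 1 < γ) : Tendsto (psiB γ) atTop atTop := by
  have : Tendsto (fun q => kappa γ * (√q - 2)) atTop atTop :=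
    (tendsto_atTop_add_const_right _ (-2) Real.tendsto_sqrt_atTop).const_mul_atTop (kappa_pos hγ)
  exact tendsto_atTop_mono' _ ((eventually_ge_atTop 1).mono fun q hq => sqrt_sub_le_psiB hγ hq) this

lemma tendsto_psiB_zero (hγ : 1 < γ) : Tendsto (psiB γ) (𝓝[>] 0) (𝓝 (-nu γ)) := by
  have h : Tendsto (fun q : ℝ => nu γ * (q ^ zeta γ - 1)) (𝓝 0) (𝓝 (nu γ * (0 ^ zeta γ - 1))) :=
    (((Real.continuousAt_rpow_const 0 (zeta γ) (Or.inr (zeta_pos hγ).le)).sub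
      continuousAt_const).const_mul (nu γ))
  rw [Real.zero_rpow (zeta_pos hγ).ne', zero_sub, mul_neg_one] at h
  refine (h.mono_left nhdsWithin_le_nhds).congr' ?_
  filter_upwards [nhdsWithin_le_nhds (Iic_mem_nhds (zero_lt_one (α := ℝ)))] with q hq
  exact (psiB_of_le hq).symm

/-- `q ^ (-ζ) ψ(q)` is unbounded, since `ψ` grows like `√q` and `ζ < 1 / 2`. -/
lemma tendsto_rpow_neg_mul_psiB (hγ : 1 < γ) :
    Tendsto (fun q => q ^ (-zeta γ) * psiB γ q) atTop atTop := by
  have hz := zeta_pos hγ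
  have hk := kappa_pos hγ
  have h1 : Tendsto (fun q : ℝ => kappa γ * (q ^ (1 / 2 - zeta γ) - 2)) atTop atTop :=
    (tendsto_atTop_add_const_right _ (-2)
      (tendsto_rpow_atTop (by linarith [zeta_lt_half hγ]))).const_mul_atTop hk
  refine tendsto_atTop_mono' _ ((eventually_ge_atTop 1).mono fun q hq => ?_) h1
  have hq0 : 0 < q := by linarith
  have h2 := sqrt_sub_le_psiB hγ hq
  have h3 : q ^ (1 / 2 - zeta γ) = q ^ (-zeta γ) * √q := by
    rw [Real.sqrt_eq_rpow, ← Real.rpow_add hq0]; congr 1; ring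
  have h4 := Real.rpow_pos_of_pos hq0 (-zeta γ)
  have h5 : q ^ (-zeta γ) ≤ 1 := Real.rpow_le_one_of_one_le_of_nonpos hq (by linarith)
  rw [h3]
  have h6 := mul_le_mul_of_nonneg_left h2 h4.le
  nlinarith

/-! ### The ratio of impedances -/

lemma impRatio_of_le (hγ : 1 < γ) {q : ℝ} (h : 0 < q) (hq : q ≤ 1) :
    impRatio γ q = q ^ zeta γ := by
  have : q * q ^ (-(1 / γ)) = q ^ zeta γ * q ^ zeta γ := by
    nth_rw 1 [← Real.rpow_one q]
    rw [← Real.rpow_add h, ← Real.rpow_add h, one_div_gamma hγ]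
    congr 1; ring
  rw [impRatio, phiB, if_pos hq, this, Real.sqrt_mul_self (Real.rpow_nonneg h.le _)]

lemma impRatio_of_ge {q : ℝ} (h : -1 < aPar γ) (hq : 1 ≤ q) :
    impRatio γ q = √(q * (1 + aPar γ * q) / (q + aPar γ)) := by
  rcases hq.eq_or_lt with rfl | hq
  · have : (1 : ℝ) + aPar γ ≠ 0 := by linarith
    simp [impRatio, phiB, div_self this]
  · rw [impRatio, phiB, if_neg hq.not_ge, mul_div_assoc]

lemma phiB_pos (hγ : 1 < γ) {q : ℝ} (h : 0 < q) : 0 < phiB γ q := by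
  have := aPar_pos hγ
  unfold phiB
  split_ifs <;> positivity

lemma impRatio_pos (hγ : 1 < γ) {q : ℝ} (h : 0 < q) : 0 < impRatio γ q :=
  Real.sqrt_pos.2 (mul_pos h (phiB_pos hγ h))

/-- Across a shock `√(τ p)` grows faster than along the rarefaction curve. -/
lemma rpow_lt_impRatio (hγ : 1 < γ) {q : ℝ} (hq : 1 < q) : q ^ zeta γ < impRatio γ q := by
  have h0 := aPar_pos hγ
  have h1 := aPar_lt_one hγ
  have hd : ∀ p : ℝ, 0 < p → HasDerivAt
      (fun p : ℝ => p ^ (1 - 2 * zeta γ) * ((1 + aPar γ * p) / (p + aPar γ)))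
      (p ^ (-(2 * zeta γ)) * (aPar γ * (1 - aPar γ) / (1 + aPar γ) * (p - 1) ^ 2
        / (p + aPar γ) ^ 2)) p := by
    intro p hp
    have hp' : p + aPar γ ≠ 0 := by linarith
    have d1 : HasDerivAt (fun p : ℝ => p ^ (1 - 2 * zeta γ)) _ p :=
      Real.hasDerivAt_rpow_const (p := 1 - 2 * zeta γ) (Or.inl hp.ne')
    have d2 : HasDerivAt (fun p : ℝ => 1 + aPar γ * p) (aPar γ * 1) p :=
      ((hasDerivAt_id p).const_mul (aPar γ)).const_add 1
    have d3 : HasDerivAt (fun p : ℝ => p + aPar γ) 1 p := (hasDerivAt_id p).add_const (aPar γ)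
    refine (d1.mul (d2.div d3 hp')).congr_deriv ?_
    have e1 : p ^ (1 - 2 * zeta γ) = p ^ (-(2 * zeta γ)) * p := by
      rw [sub_eq_neg_add, Real.rpow_add_one hp.ne']
    have e2 : 1 - 2 * zeta γ - 1 = -(2 * zeta γ) := by ring
    simp only [Pi.div_apply]
    rw [e1, e2]
    set r := p ^ (-(2 * zeta γ))
    clear_value r
    rw [zeta]
    have : 1 + aPar γ ≠ 0 := by linarith
    field_simp
    ring
  have hmono : StrictMonoOn
      (fun p : ℝ => p ^ (1 - 2 * zeta γ) * ((1 + aPar γ * p) / (p + aPar γ))) (Ici 1) := by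
    refine strictMonoOn_of_deriv_pos (convex_Ici _) (fun p hp =>
      (hd p (zero_lt_one.trans_le hp)).continuousAt.continuousWithinAt) fun p hp => ?_
    rw [interior_Ici, mem_Ioi] at hp
    rw [(hd p (by linarith)).deriv]
    have : 0 < p - 1 := by linarith
    have : 0 < 1 - aPar γ := by linarith
    have : 0 < p := by linarith
    positivity
  have h2 := hmono self_mem_Ici hq.le hq
  simp only [Real.one_rpow, mul_one, div_self (show 1 + aPar γ ≠ 0 by linarith)] at h2
  have hq0 : 0 < q := by linarith
  rw [impRatio_of_ge (by linarith) hq.le]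
  refine Real.lt_sqrt_of_sq_lt ?_
  have e3 : q * (1 + aPar γ * q) / (q + aPar γ) =
      (q ^ zeta γ) ^ 2 * (q ^ (1 - 2 * zeta γ) * ((1 + aPar γ * q) / (q + aPar γ))) := by
    rw [← mul_assoc, ← Real.rpow_natCast, ← Real.rpow_mul hq0.le, ← Real.rpow_add hq0,
      mul_div_assoc]
    congr 1
    rw [Nat.cast_ofNat, show zeta γ * 2 + (1 - 2 * zeta γ) = 1 by ring, Real.rpow_one]
  rw [e3]
  have := pow_pos (Real.rpow_pos_of_pos hq0 (zeta γ)) 2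
  nlinarith

/-- The forward shock of strength `1 / q` undoes the velocity jump of a backward shock of
strength `q`. -/
lemma shockPsi_inv_mul_impRatio (hγ : 1 < γ) {q : ℝ} (hq : 1 ≤ q) :
    shockPsi γ q⁻¹ * impRatio γ q = -psiB γ q := by
  have h0 := aPar_pos hγ
  have hq0 : 0 < q := by linarith
  rw [impRatio_of_ge (by linarith) hq, psiB_of_ge hq, shockPsi, shockPsi]
  have e1 : q⁻¹ + aPar γ = (1 + aPar γ * q) / q := by field_simp
  have hA : 0 < 1 + aPar γ * q := by positivity
  have e2 : √(q * (1 + aPar γ * q) / (q + aPar γ)) =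
      q * √((1 + aPar γ * q) / q) / √(q + aPar γ) := by
    rw [Real.sqrt_div (by positivity)]
    congr 1
    rw [Real.sqrt_eq_iff_mul_self_eq (by positivity) (by positivity)]
    have := Real.mul_self_sqrt (show 0 ≤ (1 + aPar γ * q) / q by positivity)
    rw [mul_mul_mul_comm, this]
    field_simp
  have : √((1 + aPar γ * q) / q) ≠ 0 := (Real.sqrt_pos.2 (by positivity)).ne'
  have : √(q + aPar γ) ≠ 0 := (Real.sqrt_pos.2 (by positivity)).ne'
  rw [e1, e2]
  field_simp
  ring

/-! ### The zeros of `alpha` -/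

lemma alpha_of_ge {q : ℝ} (hq : 1 ≤ q) :
    alpha γ q = nu γ * (q ^ zeta γ - 1) - psiB γ q := by
  rw [alpha, psiF_of_ge hq]

lemma alpha_of_le {q : ℝ} (hq : q ≤ 1) : alpha γ q = shockPsi γ q - psiB γ q := by
  rw [alpha, psiF_of_le hq]

lemma alpha_pos_of_lt_one (hγ : 5 / 3 < γ) {q : ℝ} (h : 0 < q) (hq : q < 1) :
    0 < alpha γ q := by
  have hγ' : 1 < γ := by linarith
  have hd : ∀ p : ℝ, 0 < p → HasDerivAt (fun p => shockPsi γ p - psiB γ p)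
      (p ^ (zeta γ - 1) * shockSlope γ p - p ^ (zeta γ - 1) * waveSlope γ p) p :=
    fun p hp => (hasDerivAt_shockPsi hγ' hp).sub (hasDerivAt_psiB hγ' hp)
  have hanti : StrictAntiOn (fun p => shockPsi γ p - psiB γ p) (Ioc 0 1) := by
    refine strictAntiOn_of_deriv_neg (convex_Ioc _ _)
      (fun p hp => (hd p hp.1).continuousAt.continuousWithinAt) fun p hp => ?_
    rw [interior_Ioc] at hp
    rw [(hd p hp.1).deriv, ← mul_sub, waveSlope_of_le hp.2.le]
    exact mul_neg_of_pos_of_neg (Real.rpow_pos_of_pos hp.1 _)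
      (by linarith [shockSlope_lt_of_lt_one hγ hp.1 hp.2])
  have h2 := hanti ⟨h, hq.le⟩ ⟨one_pos, le_rfl⟩ hq
  rw [alpha_of_le hq.le]
  simpa [shockPsi] using h2

lemma exists_alpha_sign_change (hγ : 5 / 3 < γ) :
    ∃ y₀, 1 < y₀ ∧ alpha γ y₀ = 0 ∧ (∀ y, 1 < y → y < y₀ → 0 < alpha γ y) ∧
      ∀ y, y₀ < y → alpha γ y < 0 := by
  have hγ' : 1 < γ := by linarith
  have hm := one_lt_slopeMin hγ
  have hd : ∀ y : ℝ, 0 < y → HasDerivAt (fun y => nu γ * (y ^ zeta γ - 1) - psiB γ y)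
      (y ^ (zeta γ - 1) * (nu γ * zeta γ - waveSlope γ y)) y := by
    intro y hy
    refine ((((Real.hasDerivAt_rpow_const (p := zeta γ) (Or.inl hy.ne')).sub_const 1).const_mul
      (nu γ)).sub (hasDerivAt_psiB hγ' hy)).congr_deriv ?_
    ring
  obtain ⟨z, hz, hz0, hz1, hz2⟩ := exists_sign_change (c := 1)
    (f := fun y => nu γ * (y ^ zeta γ - 1) - psiB γ y)
    (w := fun y => y ^ (zeta γ - 1)) (g := fun y => nu γ * zeta γ - waveSlope γ y)
    (fun y hy => (hd y (zero_lt_one.trans_le hy)).continuousAt.continuousWithinAt)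
    (fun y hy => hd y (by linarith)) (fun y hy => Real.rpow_pos_of_pos (by linarith) _)
    (by
      intro y hy h z hz
      rw [sub_nonpos, ← waveSlope_of_le le_rfl] at h
      have h1 := slopeMin_lt_of_waveSlope_le hγ' hy hy h
      rw [sub_neg, ← waveSlope_of_le le_rfl]
      exact h.trans_lt (waveSlope_lt_of_slopeMin_le hγ h1.le hz))
    ⟨slopeMin γ, hm, by
      rw [sub_pos, ← waveSlope_of_le le_rfl]
      exact waveSlope_lt_of_lt hγ' hm hm le_rfl⟩
    (by simp)
    (by
      obtain ⟨q, hq, hq1⟩ := (((tendsto_rpow_neg_mul_psiB hγ').eventually_gt_atTop (nu γ)).and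
        (eventually_gt_atTop 1)).exists
      refine ⟨q, hq1, ?_⟩
      have hq0 : 0 < q := by linarith
      have h1 := Real.rpow_pos_of_pos hq0 (zeta γ)
      have h2 := mul_lt_mul_of_pos_left hq h1
      rw [← mul_assoc, ← Real.rpow_add hq0, add_neg_cancel, Real.rpow_zero, one_mul] at h2
      linarith [nu_pos hγ'])
  refine ⟨z, hz, ?_, fun y hy hyz => ?_, fun y hy => ?_⟩
  · rw [alpha_of_ge hz.le]; exact hz0
  · rw [alpha_of_ge hy.le]; exact hz1 y hy hyz
  · rw [alpha_of_ge (hz.trans hy).le]; exact hz2 y hy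

/-! ### The reflection criterion -/

/-- The velocity defect at the pressure of the right-most state: the reflected wave is a
rarefaction, absent or a shock according as this is positive, zero or negative. -/
noncomputable def reflDefect (γ x y : ℝ) : ℝ :=
  psiB γ (x * y) - psiB γ x - psiB γ y * impRatio γ x

lemma reflDefect_one_right (γ x : ℝ) : reflDefect γ x 1 = 0 := by simp [reflDefect]

lemma hasDerivAt_reflDefect (hγ : 1 < γ) {x y : ℝ} (hx : 0 < x) (hy : 0 < y) :
    HasDerivAt (reflDefect γ x) (y ^ (zeta γ - 1) *
      (x ^ zeta γ * waveSlope γ (x * y) - impRatio γ x * waveSlope γ y)) y := by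
  have d1 : HasDerivAt (fun y : ℝ => x * y) (x * 1) y := (hasDerivAt_id y).const_mul x
  have d2 : HasDerivAt (fun y => psiB γ (x * y)) _ y :=
    (hasDerivAt_psiB hγ (mul_pos hx hy)).comp y d1
  refine ((d2.sub_const (psiB γ x)).sub
    ((hasDerivAt_psiB hγ hy).mul_const (impRatio γ x))).congr_deriv ?_
  rw [Real.mul_rpow hx.le hy.le]
  have : x ^ zeta γ = x ^ (zeta γ - 1) * x := by
    rw [← Real.rpow_add_one hx.ne', sub_add_cancel]
  rw [this]
  ring

lemma continuousOn_reflDefect (hγ : 1 < γ) {x : ℝ} (hx : 0 < x) :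
    ContinuousOn (reflDefect γ x) (Ioi 0) :=
  fun _ hy => (hasDerivAt_reflDefect hγ hx hy).continuousAt.continuousWithinAt

/-! ### A rarefaction followed by a shock -/

/-- While the two waves amount to a rarefaction in total (`x * y ≤ 1`), the type of the reflected
wave depends on `y` only. -/
lemma reflDefect_of_mul_le_one (hγ : 1 < γ) {x y : ℝ} (hx : 0 < x) (hx1 : x ≤ 1) (hy : 1 ≤ y)
    (hxy : x * y ≤ 1) : reflDefect γ x y = x ^ zeta γ * alpha γ y := by
  rw [reflDefect, psiB_of_le hxy, psiB_of_le hx1, impRatio_of_le hγ hx hx1, alpha_of_ge hy,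
    Real.mul_rpow hx.le (by linarith)]
  ring

lemma reflDefect_of_alpha_eq_zero (hγ : 1 < γ) {x y : ℝ} (hx : 0 < x) (hx1 : x ≤ 1)
    (hy : 1 ≤ y) (hxy : 1 ≤ x * y) (h : alpha γ y = 0) :
    reflDefect γ x y = -alpha γ (x * y) := by
  rw [alpha_of_ge hy, sub_eq_zero] at h
  rw [reflDefect, psiB_of_le hx1, impRatio_of_le hγ hx hx1, ← h, alpha_of_ge hxy,
    Real.mul_rpow hx.le (by linarith)]
  ring

lemma exists_rarefaction_shock_sign_change (hγ : 5 / 3 < γ) {x : ℝ} (hx : 0 < x) (hx1 : x < 1) :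
    ∃ z, 1 < z ∧ reflDefect γ x z = 0 ∧ (∀ y, 1 < y → y < z → 0 < reflDefect γ x y) ∧
      ∀ y, z < y → reflDefect γ x y < 0 := by
  have hγ' : 1 < γ := by linarith
  have hm := one_lt_slopeMin hγ
  have hxz : 0 < x ^ zeta γ := Real.rpow_pos_of_pos hx _
  have hlt : ∀ y : ℝ, 0 < y → x * y < y := fun y hy => by nlinarith
  refine exists_sign_change (c := 1) (f := reflDefect γ x)
    (w := fun y => x ^ zeta γ * y ^ (zeta γ - 1))
    (g := fun y => waveSlope γ (x * y) - waveSlope γ y)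
    ((continuousOn_reflDefect hγ' hx).mono (Ici_subset_Ioi.2 one_pos))
    (fun y hy => ?_) (fun y hy => mul_pos hxz (Real.rpow_pos_of_pos (by linarith) _))
    ?_ ⟨slopeMin γ, hm, sub_pos.2 (waveSlope_lt_of_lt hγ' (hlt _ (by linarith)) hm le_rfl)⟩
    (reflDefect_one_right γ x) ?_
  · refine (hasDerivAt_reflDefect hγ' hx (by linarith : 0 < y)).congr_deriv ?_
    rw [impRatio_of_le hγ' hx hx1.le]
    ring
  · intro y hy h z hz
    rw [sub_nonpos] at h
    have h1 := slopeMin_lt_of_waveSlope_le hγ' (hlt y (by linarith)) hy h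
    have h2 := waveSlope_lt_of_slopeMin_le hγ h1.le hz
    rw [sub_neg]
    rcases le_total (x * z) (slopeMin γ) with h3 | h3
    · have h4 : x * y ≤ x * z := mul_le_mul_of_nonneg_left hz.le hx.le
      linarith [waveSlope_le_of_le hγ' h4 h3]
    · exact waveSlope_lt_of_slopeMin_le hγ h3 (hlt z (by linarith))
  · -- compare the growth rates `√x` and `x ^ ζ` of the two shock terms
    have hk := kappa_pos hγ'
    have hs : √x < x ^ zeta γ := by
      rw [Real.sqrt_eq_rpow]
      exact Real.rpow_lt_rpow_of_exponent_gt hx hx1 (zeta_lt_half hγ')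
    have h1 : Tendsto (fun y : ℝ => kappa γ * (x ^ zeta γ - √x) * √y) atTop atTop :=
      Real.tendsto_sqrt_atTop.const_mul_atTop (mul_pos hk (by linarith))
    obtain ⟨y, hy, hy1⟩ := ((h1.eventually_gt_atTop
      (2 * kappa γ * x ^ zeta γ - psiB γ x)).and (eventually_gt_atTop 1)).exists
    refine ⟨y, hy1, ?_⟩
    have h2 := psiB_le_sqrt hγ' (mul_pos hx (show 0 < y by linarith))
    have h3 := mul_le_mul_of_nonneg_right (sqrt_sub_le_psiB hγ' hy1.le) hxz.le
    rw [Real.sqrt_mul hx.le] at h2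
    rw [reflDefect, impRatio_of_le hγ' hx hx1.le]
    linarith

/-! ### Quotients `(ψ(q) + c) / q ^ ζ` -/

lemma hasDerivAt_rpow_neg_mul_psiB_add (hγ : 1 < γ) (c : ℝ) {q : ℝ} (hq : 0 < q) :
    HasDerivAt (fun q => q ^ (-zeta γ) * (psiB γ q + c))
      (q ^ (-zeta γ - 1) * (q ^ zeta γ * waveSlope γ q - zeta γ * (psiB γ q + c))) q := by
  refine ((Real.hasDerivAt_rpow_const (p := -zeta γ) (Or.inl hq.ne')).mul
    ((hasDerivAt_psiB hγ hq).add_const c)).congr_deriv ?_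
  have e1 : q ^ (-zeta γ) = q ^ (-zeta γ - 1) * q := by
    rw [← Real.rpow_add_one hq.ne', sub_add_cancel]
  have e2 : q ^ zeta γ = q ^ (zeta γ - 1) * q := by
    rw [← Real.rpow_add_one hq.ne', sub_add_cancel]
  rw [e1, e2]
  ring

/-- `q ψ'(q)` on the shock branch. -/
lemma rpow_zeta_mul_shockSlope {q : ℝ} (hq : 0 < q) :
    q ^ zeta γ * shockSlope γ q =
      kappa γ * (q * (q + 1 + 2 * aPar γ)) / (2 * √(q + aPar γ) ^ 3) := by
  rw [shockSlope, ← mul_assoc, ← Real.rpow_add hq, add_sub_cancel, Real.rpow_one]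
  ring

lemma strictMonoOn_rpow_neg_mul_psiB_sub (hγ : 1 < γ) :
    StrictMonoOn (fun q => q ^ (-zeta γ) * (psiB γ q + -nu γ)) (Ioi 0) := by
  refine strictMonoOn_Ioi_of_hasDerivAt
    (fun q hq => hasDerivAt_rpow_neg_mul_psiB_add hγ (-nu γ) hq)
    fun q hq => mul_pos (Real.rpow_pos_of_pos hq _) ?_
  have h0 := aPar_pos hγ
  have h1 := aPar_lt_one hγ
  have hn := nu_pos hγ
  have hz := zeta_pos hγ
  have hk := kappa_pos hγ
  rcases le_total q 1 with h | h
  · rw [psiB_of_le h, waveSlope_of_le h]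
    have : 0 < nu γ * zeta γ := mul_pos hn hz
    linarith
  · rw [waveSlope_of_ge hγ h, rpow_zeta_mul_shockSlope hq]
    have hp : 0 < q + aPar γ := by linarith
    have hs : 0 < √(q + aPar γ) := Real.sqrt_pos.2 hp
    have h3 : √(q + aPar γ) ^ 3 = √(q + aPar γ) * (q + aPar γ) := by
      rw [pow_succ', Real.sq_sqrt hp.le]
    have h2 : zeta γ * psiB γ q ≤
        kappa γ * (q * (q + 1 + 2 * aPar γ)) / (2 * √(q + aPar γ) ^ 3) := by
      rw [psiB_of_ge h, shockPsi, h3, zeta, div_mul_div_comm,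
        div_le_div_iff₀ (by positivity) (by positivity)]
      have : aPar γ * (q - 1) * (2 * (q + aPar γ)) ≤
          q * (q + 1 + 2 * aPar γ) * (1 + aPar γ) := by
        have h5 : 0 ≤ (1 - aPar γ) * q ^ 2 := mul_nonneg (by linarith) (sq_nonneg q)
        have h6 : 0 ≤ aPar γ * q := by positivity
        nlinarith
      have := mul_le_mul_of_nonneg_left this (mul_pos hk hs).le
      linarith
    have : 0 < zeta γ * nu γ := mul_pos hz hn
    linarith

/-- For `q > ȳ` one has `ζ (ψ(q) + ν) < q ψ'(q)`, with equality at `q = ȳ`, so that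
`(ψ(q) + ν) / q ^ ζ` increases beyond `ȳ`. -/
lemma strictMonoOn_rpow_neg_mul_psiB_add (hγ : 5 / 3 < γ) :
    1 < yBar γ ∧
      StrictMonoOn (fun q => q ^ (-zeta γ) * (psiB γ q + nu γ)) (Ici (yBar γ)) := by
  have hγ' : 1 < γ := by linarith
  have h0 := aPar_pos hγ'
  have h1 := aPar_lt_one hγ'
  have h4 := quarter_lt_aPar hγ
  have hk := kappa_pos hγ'
  set r := √(aPar γ) with hr
  have hr2 : r ^ 2 = aPar γ := Real.sq_sqrt h0.le
  have hr0 : 0 < r := Real.sqrt_pos.2 h0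
  have hr1 : r < 1 := by nlinarith
  have hrh : 1 / 2 < r := by nlinarith
  have hrp : 0 < 1 - r := by linarith
  have hy : 1 + aPar γ ≠ 0 := by linarith
  have hybar : yBar γ + aPar γ = (1 + aPar γ) * (r / (1 - r)) ^ 2 := by
    rw [yBar, ← hr, ← hr2]
    field_simp
    ring
  have hT : 1 < r / (1 - r) := by rw [lt_div_iff₀ hrp]; linarith
  have hy1 : 1 < yBar γ := by
    have : 1 < (r / (1 - r)) ^ 2 := one_lt_pow₀ hT two_ne_zero
    nlinarith
  refine ⟨hy1, ?_⟩
  refine strictMonoOn_of_deriv_pos (convex_Ici _) (fun q hq =>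
    (hasDerivAt_rpow_neg_mul_psiB_add hγ' (nu γ)
      (by linarith [mem_Ici.1 hq])).continuousAt.continuousWithinAt) fun q hq => ?_
  rw [interior_Ici, mem_Ioi] at hq
  have hq0 : 0 < q := by linarith
  rw [(hasDerivAt_rpow_neg_mul_psiB_add hγ' (nu γ) hq0).deriv]
  refine mul_pos (Real.rpow_pos_of_pos hq0 _) ?_
  rw [waveSlope_of_ge hγ' (by linarith), rpow_zeta_mul_shockSlope hq0,
    psiB_of_ge (by linarith), shockPsi, mul_add (zeta γ), mul_comm (zeta γ) (nu γ), nu_mul_zeta hγ', zeta]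
  -- in terms of `t = √((q + a) / (1 + a))` the claim is a polynomial inequality
  set e := √(1 + aPar γ) with he
  have he0 : 0 < e := Real.sqrt_pos.2 (by linarith)
  have he2 : e ^ 2 = 1 + aPar γ := Real.sq_sqrt (by linarith)
  obtain ⟨t, ht⟩ : ∃ t, t = √(q + aPar γ) / e := ⟨_, rfl⟩
  have hs : √(q + aPar γ) = e * t := by rw [ht]; field_simp
  have hsq : q + aPar γ = e ^ 2 * t ^ 2 := by
    rw [← mul_pow, ← hs, Real.sq_sqrt (by linarith)]
  have ht0 : 0 < t := by rw [ht]; exact div_pos (Real.sqrt_pos.2 (by linarith)) he0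
  have htT : r / (1 - r) < t := by
    have : (r / (1 - r)) ^ 2 < t ^ 2 := by
      have : (1 + aPar γ) * (r / (1 - r)) ^ 2 < (1 + aPar γ) * t ^ 2 := by
        rw [← hybar, ← he2, ← hsq]; linarith
      exact lt_of_mul_lt_mul_left this (by linarith)
    exact lt_of_pow_lt_pow_left₀ 2 ht0.le this
  have htr : r < t * (1 - r) := (div_lt_iff₀ hrp).1 htT
  have hpoly : 0 < (t - 1) ^ 2 * ((1 - r) * t - r) * ((1 + r) * t + r) := by
    have : 0 < t - 1 := by linarith
    have : 0 < (1 - r) * t - r := by linarith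
    positivity
  rw [hs, ← he2]
  have hqe : q = e ^ 2 * t ^ 2 - aPar γ := by linarith
  have key : kappa γ * (q * (q + 1 + 2 * aPar γ)) / (2 * (e * t) ^ 3) -
      (aPar γ / e ^ 2 * (kappa γ * (q - 1) / (e * t)) + kappa γ / e) =
      kappa γ / (2 * e * t ^ 3) * ((t - 1) ^ 2 * ((1 - r) * t - r) * ((1 + r) * t + r)) := by
    have ha : aPar γ = e ^ 2 - 1 := by linarith
    have hr2' : r ^ 2 = e ^ 2 - 1 := by linarith
    have hrr : (t - 1) ^ 2 * ((1 - r) * t - r) * ((1 + r) * t + r) =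
        (t - 1) ^ 2 * (t ^ 2 - r ^ 2 * t ^ 2 - 2 * r ^ 2 * t - r ^ 2) := by ring
    rw [hqe, hrr, hr2', ha]
    field_simp
    ring
  rw [key]
  positivity

/-- On the hyperbola `x * y = ȳ` the defect is, up to the factor `ȳ ^ ζ`, the difference of the
values of `(ψ(q) + ν) / q ^ ζ` at `ȳ` and at `ȳ / x`. -/
lemma reflDefect_yBar_div_neg (hγ : 5 / 3 < γ) {x : ℝ} (hx : 0 < x) (hx1 : x < 1) :
    reflDefect γ x (yBar γ / x) < 0 := by
  have hγ' : 1 < γ := by linarith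
  obtain ⟨hy, hmono⟩ := strictMonoOn_rpow_neg_mul_psiB_add hγ
  have hy0 : 0 < yBar γ := by linarith
  have hlt : yBar γ < yBar γ / x := by rw [lt_div_iff₀ hx]; nlinarith
  have h := hmono self_mem_Ici hlt.le hlt
  simp only at h
  have hP := Real.rpow_pos_of_pos hy0 (zeta γ)
  have h2 := mul_lt_mul_of_pos_left h hP
  rw [reflDefect, psiB_of_le hx1.le, impRatio_of_le hγ' hx hx1.le, mul_div_cancel₀ _ hx.ne']
  rw [← mul_assoc, ← mul_assoc, Real.div_rpow hy0.le hx.le, Real.rpow_neg hy0.le,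
    Real.rpow_neg hx.le] at h2
  have h3 := Real.rpow_pos_of_pos hx (zeta γ)
  have e1 : yBar γ ^ zeta γ * ((yBar γ ^ zeta γ)⁻¹ / (x ^ zeta γ)⁻¹) = x ^ zeta γ := by
    field_simp
  rw [e1, mul_inv_cancel₀ hP.ne'] at h2
  linarith

/-! ### Two shocks -/

lemma impRatio_eq_sqrt_div (hγ : 1 < γ) {x : ℝ} (hx : 1 ≤ x) :
    impRatio γ x = √(x * (1 + aPar γ * x)) / √(x + aPar γ) := by
  have h0 := aPar_pos hγ
  have : 0 < x := by linarith
  rw [impRatio_of_ge (by linarith) hx, Real.sqrt_div (by positivity)]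

/-- For two shocks the reflection criterion, cleared of its square roots, is a quadratic
polynomial in `y`. -/
lemma exists_reflDefect_shock_shock (hγ : 1 < γ) {x y : ℝ} (hx : 1 < x) (hy : 1 < y) :
    ∃ c, 0 < c ∧ reflDefect γ x y = c * ((1 - aPar γ) ^ 2 * x * y ^ 2 -
      4 * aPar γ ^ 2 * (1 + x) * y - 4 * aPar γ ^ 3) := by
  have h0 := aPar_pos hγ
  have h1 := aPar_lt_one hγ
  have hk := kappa_pos hγ
  have hx0 : 0 < x := by linarith
  have hy0 : 0 < y := by linarith
  have hx1 : 0 < x - 1 := by linarith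
  have hy1 : 0 < y - 1 := by linarith
  have hxy : 1 < x * y := by nlinarith
  have hxy1 : 0 < x * y - 1 := by linarith
  rw [reflDefect, impRatio_eq_sqrt_div hγ hx.le, psiB_of_ge hxy.le, psiB_of_ge hx.le,
    psiB_of_ge hy.le, shockPsi, shockPsi, shockPsi]
  obtain ⟨X, hX⟩ : ∃ X, X = √(x + aPar γ) := ⟨_, rfl⟩
  obtain ⟨Y, hY⟩ : ∃ Y, Y = √(y + aPar γ) := ⟨_, rfl⟩
  obtain ⟨Z, hZ⟩ : ∃ Z, Z = √(x * y + aPar γ) := ⟨_, rfl⟩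
  obtain ⟨W, hW⟩ : ∃ W, W = √(x * (1 + aPar γ * x)) := ⟨_, rfl⟩
  have hX0 : 0 < X := hX ▸ Real.sqrt_pos.2 (by positivity)
  have hY0 : 0 < Y := hY ▸ Real.sqrt_pos.2 (by positivity)
  have hZ0 : 0 < Z := hZ ▸ Real.sqrt_pos.2 (by positivity)
  have hW0 : 0 < W := hW ▸ Real.sqrt_pos.2 (by positivity)
  have hX2 : X ^ 2 = x + aPar γ := hX ▸ Real.sq_sqrt (by positivity)
  have hY2 : Y ^ 2 = y + aPar γ := hY ▸ Real.sq_sqrt (by positivity)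
  have hZ2 : Z ^ 2 = x * y + aPar γ := hZ ▸ Real.sq_sqrt (by positivity)
  have hW2 : W ^ 2 = x * (1 + aPar γ * x) := hW ▸ Real.sq_sqrt (by positivity)
  rw [← hX, ← hY, ← hZ, ← hW]
  generalize aPar γ = a at *
  generalize kappa γ = k at *
  obtain ⟨M, hM⟩ : ∃ M, M = x * (x * y ^ 2 * (1 - a) + y * (1 + 3 * a) + 2 * a * x * y
    + 2 * a ^ 2) := ⟨_, rfl⟩
  have hM0 : 0 < M := by
    have : 0 < 1 - a := by linarith
    rw [hM]; positivity
  -- the two conjugates by which the square roots are cleared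
  obtain ⟨U, hU⟩ : ∃ U, U = (x * y - 1) * X * Y + ((x - 1) * Y + (y - 1) * W) * Z := ⟨_, rfl⟩
  obtain ⟨V, hV⟩ : ∃ V, V = M + 2 * Z ^ 2 * Y * W := ⟨_, rfl⟩
  have hU0 : 0 < U := by rw [hU]; positivity
  have hV0 : 0 < V := by rw [hV]; positivity
  have e1 : ((x * y - 1) * X * Y - ((x - 1) * Y + (y - 1) * W) * Z) * U =
      (x - 1) * (y - 1) * (M - 2 * Z ^ 2 * Y * W) := by
    have : ((x * y - 1) * X * Y - ((x - 1) * Y + (y - 1) * W) * Z) * U =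
      (x * y - 1) ^ 2 * X ^ 2 * Y ^ 2 - ((x - 1) ^ 2 * Y ^ 2 + (y - 1) ^ 2 * W ^ 2) * Z ^ 2
        - 2 * (x - 1) * (y - 1) * Z ^ 2 * Y * W := by rw [hU]; ring
    rw [this, hX2, hY2, hW2, hZ2, hM]
    ring
  have e2 : (M - 2 * Z ^ 2 * Y * W) * V = x * (x * y - 1) ^ 2 *
      ((1 - a) ^ 2 * x * y ^ 2 - 4 * a ^ 2 * (1 + x) * y - 4 * a ^ 3) := by
    have : (M - 2 * Z ^ 2 * Y * W) * V = M ^ 2 - 4 * (Z ^ 2) ^ 2 * Y ^ 2 * W ^ 2 := by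
      rw [hV]; ring
    rw [this, hY2, hW2, hZ2, hM]
    ring
  refine ⟨k * ((x - 1) * (y - 1)) * (x * (x * y - 1) ^ 2) / (X * Y * Z * U * V),
    by positivity, ?_⟩
  have e3 : k * (x * y - 1) / Z - k * (x - 1) / X - k * (y - 1) / Y * (W / X) =
      k * (((x * y - 1) * X * Y - ((x - 1) * Y + (y - 1) * W) * Z)) / (X * Y * Z) := by
    field_simp
    ring
  rw [e3, div_mul_eq_mul_div, div_eq_div_iff (by positivity) (by positivity)]
  linear_combination (k * X * Y * Z * V) * e1 + (k * X * Y * Z * (x - 1) * (y - 1)) * e2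

/-- `jCurve γ x` is the positive root of that quadratic polynomial. -/
lemma exists_quadratic_eq_mul_sub_jCurve (hγ : 1 < γ) {x y : ℝ} (hx : 0 < x) (hy : 0 < y) :
    ∃ c, 0 < c ∧ (1 - aPar γ) ^ 2 * x * y ^ 2 - 4 * aPar γ ^ 2 * (1 + x) * y - 4 * aPar γ ^ 3 =
      c * (y - jCurve γ x) := by
  have h0 := aPar_pos hγ
  have h1 : 0 < 1 - aPar γ := by linarith [aPar_lt_one hγ]
  obtain ⟨s, hs⟩ : ∃ s, s = √(aPar γ ^ 2 * (1 + x) ^ 2 + aPar γ * x * (1 - aPar γ) ^ 2) :=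
    ⟨_, rfl⟩
  have hs2 : s ^ 2 = aPar γ ^ 2 * (1 + x) ^ 2 + aPar γ * x * (1 - aPar γ) ^ 2 := by
    rw [hs]; exact Real.sq_sqrt (by positivity)
  have hsA : aPar γ * (1 + x) < s := by
    rw [hs]
    refine Real.lt_sqrt_of_sq_lt ?_
    have : 0 < aPar γ * x * (1 - aPar γ) ^ 2 := by positivity
    nlinarith
  rw [jCurve, ← hs]
  generalize aPar γ = a at *
  have : 0 < s - a * (1 + x) := by linarith
  refine ⟨(1 - a) ^ 2 * x * (y + 2 * a / ((1 - a) ^ 2 * x) * (s - a * (1 + x))),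
    by positivity, ?_⟩
  field_simp
  linear_combination (4 * a ^ 2) * hs2

lemma exists_reflDefect_eq_mul_sub_jCurve (hγ : 1 < γ) {x y : ℝ} (hx : 1 < x) (hy : 1 < y) :
    ∃ c, 0 < c ∧ reflDefect γ x y = c * (y - jCurve γ x) := by
  obtain ⟨c, hc, h⟩ := exists_reflDefect_shock_shock hγ hx hy
  obtain ⟨d, hd, h'⟩ := exists_quadratic_eq_mul_sub_jCurve hγ (x := x) (y := y)
    (by linarith) (by linarith)
  exact ⟨c * d, mul_pos hc hd, by rw [h, h', mul_assoc]⟩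

/-- `jCurve γ` in the variable `1 / x`, in which it is visibly increasing and continuous
at `0`. -/
lemma jCurve_eq_inv (hγ : 1 < γ) {x : ℝ} (hx : 0 < x) :
    jCurve γ x = 2 * aPar γ / (1 - aPar γ) ^ 2 * (aPar γ * (x⁻¹ + 1) +
      √(aPar γ ^ 2 * (x⁻¹ + 1) ^ 2 + aPar γ * x⁻¹ * (1 - aPar γ) ^ 2)) := by
  have h0 := aPar_pos hγ
  have h1 : 0 < 1 - aPar γ := by linarith [aPar_lt_one hγ]
  have : √(aPar γ ^ 2 * (1 + x) ^ 2 + aPar γ * x * (1 - aPar γ) ^ 2) =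
      x * √(aPar γ ^ 2 * (x⁻¹ + 1) ^ 2 + aPar γ * x⁻¹ * (1 - aPar γ) ^ 2) := by
    rw [Real.sqrt_eq_iff_mul_self_eq (by positivity) (by positivity), mul_mul_mul_comm,
      Real.mul_self_sqrt (by positivity)]
    field_simp
  rw [jCurve, this]
  field_simp

lemma strictAntiOn_jCurve (hγ : 1 < γ) : StrictAntiOn (jCurve γ) (Ioi 0) := by
  intro x hx y hy hxy
  have h0 := aPar_pos hγ
  have h1 : 0 < 1 - aPar γ := by linarith [aPar_lt_one hγ]
  have hx' : 0 < x := hx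
  have hy' : 0 < y := hy
  rw [jCurve_eq_inv hγ hx, jCurve_eq_inv hγ hy]
  have h : y⁻¹ < x⁻¹ := inv_strictAnti₀ hx' hxy
  gcongr

lemma tendsto_jCurve_atTop (hγ : 1 < γ) : Tendsto (jCurve γ) atTop (𝓝 (yStar γ)) := by
  have h0 := aPar_pos hγ
  have hcont : Continuous fun z : ℝ => 2 * aPar γ / (1 - aPar γ) ^ 2 * (aPar γ * (z + 1) +
      √(aPar γ ^ 2 * (z + 1) ^ 2 + aPar γ * z * (1 - aPar γ) ^ 2)) := by fun_prop
  have h := (hcont.tendsto 0).comp (tendsto_inv_atTop_zero (𝕜 := ℝ))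
  have e : 2 * aPar γ / (1 - aPar γ) ^ 2 * (aPar γ * (0 + 1) +
      √(aPar γ ^ 2 * (0 + 1) ^ 2 + aPar γ * 0 * (1 - aPar γ) ^ 2)) = yStar γ := by
    rw [zero_add, mul_one, one_pow, mul_one, mul_zero, zero_mul, add_zero, Real.sqrt_sq h0.le,
      yStar]
    ring
  rw [e] at h
  refine h.congr' ((eventually_gt_atTop 0).mono fun x hx => ?_)
  exact (jCurve_eq_inv hγ hx).symm

lemma continuousAt_jCurve {x : ℝ} (hγ : 1 < γ) (hx : 0 < x) : ContinuousAt (jCurve γ) x := by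
  have h1 : 0 < 1 - aPar γ := by linarith [aPar_lt_one hγ]
  have : (1 - aPar γ) ^ 2 * x ≠ 0 := by positivity
  unfold jCurve
  fun_prop (disch := assumption)

lemma jCurve_one (hγ : 1 < γ) : jCurve γ 1 = yBar γ := by
  have h0 := aPar_pos hγ
  have h1 := aPar_lt_one hγ
  rw [jCurve, yBar]
  set r := √(aPar γ) with hr
  have hr2 : aPar γ = r ^ 2 := (Real.sq_sqrt h0.le).symm
  have hr0 : 0 < r := Real.sqrt_pos.2 h0
  have hr1 : r < 1 := by nlinarith
  have : √(aPar γ ^ 2 * (1 + 1) ^ 2 + aPar γ * 1 * (1 - aPar γ) ^ 2) = r * (1 + r ^ 2) := by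
    rw [Real.sqrt_eq_iff_mul_self_eq (by positivity) (by positivity), hr2]
    ring
  rw [this, hr2]
  have e1 : 1 - r ≠ 0 := by linarith
  have e2 : 1 - r ^ 2 ≠ 0 := by nlinarith
  field_simp
  ring

lemma one_lt_xBar (hγ : 5 / 3 < γ) (h : γ < 2) : 1 < xBar γ := by
  have h3 := aPar_lt_third (by linarith) h
  have h4 := quarter_lt_aPar hγ
  rw [xBar, lt_div_iff₀ (by linarith)]
  nlinarith

lemma jCurve_xBar (hγ : 5 / 3 < γ) (h : γ < 2) : jCurve γ (xBar γ) = 1 := by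
  have h3 := aPar_lt_third (by linarith) h
  have hx := one_lt_xBar hγ h
  obtain ⟨c, hc, he⟩ := exists_quadratic_eq_mul_sub_jCurve (γ := γ) (by linarith)
    (x := xBar γ) (y := 1) (by linarith) one_pos
  have : (1 - aPar γ) ^ 2 * xBar γ * 1 ^ 2 - 4 * aPar γ ^ 2 * (1 + xBar γ) * 1
      - 4 * aPar γ ^ 3 = 0 := by
    have hb : (1 - 3 * aPar γ) * xBar γ = 4 * aPar γ ^ 2 := mul_div_cancel₀ _ (by linarith)
    linear_combination (1 + aPar γ) * hb
  rw [this] at he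
  rcases mul_eq_zero.1 he.symm with h | h <;> linarith

lemma yStar_two : yStar 2 = 1 := by norm_num [yStar, aPar]

lemma one_lt_yStar (h : 2 < γ) : 1 < yStar γ := by
  have h1 := aPar_lt_one (γ := γ) (by linarith)
  have h3 : 1 < 3 * aPar γ := by
    rw [aPar, ← mul_div_assoc, lt_div_iff₀ (by linarith)]; linarith
  rw [yStar, one_lt_div (pow_pos (by linarith) 2)]
  nlinarith

/-! ### A shock followed by a rarefaction -/

/-- The derivative of `reflDefect γ x` at `y = 1` has the sign of
`(1 - 3 a) x - 4 a ^ 2`, which for `γ < 2` changes at `x = xBar γ`. -/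
lemma exists_slope_sub_slope_eq (hγ : 1 < γ) {x : ℝ} (hx : 1 < x) :
    ∃ c, 0 < c ∧ x ^ zeta γ * waveSlope γ x - impRatio γ x * (nu γ * zeta γ) =
      c * ((1 - 3 * aPar γ) * x - 4 * aPar γ ^ 2) := by
  have h0 := aPar_pos hγ
  have hk := kappa_pos hγ
  have hx0 : 0 < x := by linarith
  have hx1 : 0 < x - 1 := by linarith
  rw [waveSlope_of_ge hγ hx.le, rpow_zeta_mul_shockSlope hx0, impRatio_eq_sqrt_div hγ hx.le,
    nu_mul_zeta hγ]
  obtain ⟨X, hX⟩ : ∃ X, X = √(x + aPar γ) := ⟨_, rfl⟩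
  obtain ⟨e, he⟩ : ∃ e, e = √(1 + aPar γ) := ⟨_, rfl⟩
  obtain ⟨V, hV⟩ : ∃ V, V = √(x * (1 + aPar γ * x)) := ⟨_, rfl⟩
  have hX0 : 0 < X := hX ▸ Real.sqrt_pos.2 (by positivity)
  have he0 : 0 < e := he ▸ Real.sqrt_pos.2 (by positivity)
  have hV0 : 0 < V := hV ▸ Real.sqrt_pos.2 (by positivity)
  have hX2 : X ^ 2 = x + aPar γ := hX ▸ Real.sq_sqrt (by positivity)
  have he2 : e ^ 2 = 1 + aPar γ := he ▸ Real.sq_sqrt (by positivity)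
  have hV2 : V ^ 2 = x * (1 + aPar γ * x) := hV ▸ Real.sq_sqrt (by positivity)
  rw [← hX, ← he, ← hV]
  generalize aPar γ = a at *
  generalize kappa γ = k at *
  obtain ⟨U, hU⟩ : ∃ U, U = x * (x + 1 + 2 * a) * e + 2 * X ^ 2 * V := ⟨_, rfl⟩
  have hU0 : 0 < U := by rw [hU]; positivity
  have e1 : (x * (x + 1 + 2 * a) * e - 2 * X ^ 2 * V) * U =
      x * (x - 1) ^ 2 * ((1 - 3 * a) * x - 4 * a ^ 2) := by
    have : (x * (x + 1 + 2 * a) * e - 2 * X ^ 2 * V) * U =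
      (x * (x + 1 + 2 * a)) ^ 2 * e ^ 2 - 4 * (X ^ 2) ^ 2 * V ^ 2 := by rw [hU]; ring
    rw [this, hX2, he2, hV2]
    ring
  refine ⟨k * (x * (x - 1) ^ 2) / (2 * X ^ 3 * e * U), by positivity, ?_⟩
  have e2 : k * (x * (x + 1 + 2 * a)) / (2 * X ^ 3) - V / X * (k / e) =
      k * (x * (x + 1 + 2 * a) * e - 2 * X ^ 2 * V) / (2 * X ^ 3 * e) := by
    field_simp
  rw [e2, div_mul_eq_mul_div, div_eq_div_iff (by positivity) (by positivity)]
  linear_combination (k * 2 * X ^ 3 * e) * e1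

/-- Along a shock followed by a rarefaction, the derivative of the reflection criterion in `y`
stays negative below any `y` at which it is nonpositive. -/
lemma slope_sub_slope_neg_of_le (hγ : 5 / 3 < γ) {x y z : ℝ} (hx : 1 < x)
    (hzy : z < y) (h : x ^ zeta γ * waveSlope γ (x * y) - impRatio γ x * (nu γ * zeta γ) ≤ 0) :
    x ^ zeta γ * waveSlope γ (x * z) - impRatio γ x * (nu γ * zeta γ) < 0 := by
  have hγ' : 1 < γ := by linarith
  have hxz : 0 < x ^ zeta γ := Real.rpow_pos_of_pos (by linarith) _
  have hn : 0 < nu γ * zeta γ := mul_pos (nu_pos hγ') (zeta_pos hγ')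
  have hs := mul_lt_mul_of_pos_right (rpow_lt_impRatio hγ' hx) hn
  have hlt : x * z < x * y := mul_lt_mul_of_pos_left hzy (by linarith)
  rcases le_or_gt (x * z) (slopeMin γ) with h1 | h1
  · have h2 : waveSlope γ (x * z) ≤ nu γ * zeta γ := by
      rcases le_total (x * z) 1 with h3 | h3
      · rw [waveSlope_of_le h3]
      · rw [← waveSlope_of_le (γ := γ) le_rfl]
        exact waveSlope_le_of_le hγ' h3 h1
    have := mul_le_mul_of_nonneg_left h2 hxz.le
    linarith
  · have := mul_lt_mul_of_pos_left (waveSlope_lt_of_slopeMin_le hγ h1.le hlt) hxz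
    linarith

/-- If `x` does not exceed `xBar γ`, or if `2 ≤ γ`, every reflected wave is a rarefaction. -/
lemma reflDefect_pos_of_shock_rarefaction (hγ : 5 / 3 < γ) {x y : ℝ} (hx : 1 < x)
    (hx' : (1 - 3 * aPar γ) * x ≤ 4 * aPar γ ^ 2) (hy : 0 < y) (hy1 : y < 1) :
    0 < reflDefect γ x y := by
  have hγ' : 1 < γ := by linarith
  have hx0 : 0 < x := by linarith
  obtain ⟨c, hc, he⟩ := exists_slope_sub_slope_eq hγ' hx
  have hanti : StrictAntiOn (reflDefect γ x) (Ioc 0 1) := by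
    refine strictAntiOn_of_deriv_neg (convex_Ioc _ _)
      ((continuousOn_reflDefect hγ' hx0).mono Ioc_subset_Ioi_self) fun t ht => ?_
    rw [interior_Ioc] at ht
    rw [(hasDerivAt_reflDefect hγ' hx0 ht.1).deriv, waveSlope_of_le ht.2.le]
    refine mul_neg_of_pos_of_neg (Real.rpow_pos_of_pos ht.1 _)
      (slope_sub_slope_neg_of_le hγ hx ht.2 ?_)
    rw [mul_one, he]
    exact mul_nonpos_of_nonneg_of_nonpos hc.le (by linarith)
  have := hanti ⟨hy, hy1.le⟩ ⟨one_pos, le_rfl⟩ hy1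
  rwa [reflDefect_one_right] at this

/-- For `y = 1 / x` the defect equals `alpha γ (1 / x) * impRatio γ x`. -/
lemma reflDefect_inv_pos (hγ : 5 / 3 < γ) {x : ℝ} (hx : 1 < x) : 0 < reflDefect γ x x⁻¹ := by
  have hγ' : 1 < γ := by linarith
  have hx0 : 0 < x := by linarith
  have hi : x⁻¹ < 1 := inv_lt_one_of_one_lt₀ hx
  have h1 := mul_pos (alpha_pos_of_lt_one hγ (inv_pos.2 hx0) hi) (impRatio_pos hγ' hx0)
  rw [alpha_of_le hi.le, sub_mul, shockPsi_inv_mul_impRatio hγ' hx.le] at h1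
  rw [reflDefect, mul_inv_cancel₀ hx0.ne', psiB_one]
  linarith

lemma exists_shock_rarefaction_sign_change (hγ : 5 / 3 < γ) {x : ℝ} (hx : 1 < x)
    (hx' : 4 * aPar γ ^ 2 < (1 - 3 * aPar γ) * x) :
    ∃ z, x⁻¹ < z ∧ z < 1 ∧ reflDefect γ x z = 0 ∧
      (∀ y, 0 < y → y < z → 0 < reflDefect γ x y) ∧
      ∀ y, z < y → y < 1 → reflDefect γ x y < 0 := by
  have hγ' : 1 < γ := by linarith
  have hx0 : 0 < x := by linarith
  have hxz : 0 < x ^ zeta γ := Real.rpow_pos_of_pos hx0 _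
  obtain ⟨c, hc, he⟩ := exists_slope_sub_slope_eq hγ' hx
  -- in the variable `1 / y` the sign pattern becomes that of `exists_sign_change`
  have hd : ∀ z : ℝ, 0 < z → HasDerivAt (fun z => -reflDefect γ x z⁻¹)
      ((z⁻¹ ^ (zeta γ - 1) / z ^ 2) * (x ^ zeta γ * waveSlope γ (x * z⁻¹) -
        impRatio γ x * waveSlope γ z⁻¹)) z := by
    intro z hz
    refine (((hasDerivAt_reflDefect hγ' hx0 (inv_pos.2 hz)).comp z
      (hasDerivAt_inv hz.ne')).neg).congr_deriv ?_
    ring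
  obtain ⟨z, hz, hz0, hz1, hz2⟩ := exists_sign_change (c := 1)
    (f := fun z => -reflDefect γ x z⁻¹) (w := fun z => z⁻¹ ^ (zeta γ - 1) / z ^ 2)
    (g := fun z => x ^ zeta γ * waveSlope γ (x * z⁻¹) - impRatio γ x * (nu γ * zeta γ))
    (fun z hz => (hd z (zero_lt_one.trans_le hz)).continuousAt.continuousWithinAt)
    (fun z hz => by
      have h := hd z (by linarith)
      rwa [waveSlope_of_le (inv_le_one_of_one_le₀ hz.le)] at h)
    (fun z hz => by
      have : 0 < z := by linarith
      exact div_pos (Real.rpow_pos_of_pos (inv_pos.2 this) _) (by positivity))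
    (fun z hz h t ht => slope_sub_slope_neg_of_le hγ hx
      (inv_strictAnti₀ (by linarith : 0 < z) ht) h)
    (by
      have h1 : 0 < x ^ zeta γ * shockSlope γ x - impRatio γ x * (nu γ * zeta γ) := by
        rw [← waveSlope_of_ge hγ' hx.le, he]
        exact mul_pos hc (by linarith)
      have h2 : ContinuousAt
          (fun q => x ^ zeta γ * shockSlope γ q - impRatio γ x * (nu γ * zeta γ)) x :=
        ((hasDerivAt_shockSlope hγ' hx0).continuousAt.const_mul _).sub continuousAt_const
      obtain ⟨q, ⟨hq0, hq1⟩, hqx⟩ := ((((h2.eventually_const_lt h1).and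
        (Ioi_mem_nhds hx)).filter_mono (nhdsWithin_le_nhds (s := Iio x))).and
          self_mem_nhdsWithin).exists
      have hq1 : 1 < q := hq1
      have hqx : q < x := hqx
      refine ⟨x / q, (one_lt_div (by linarith)).2 hqx, ?_⟩
      rw [inv_div, mul_div_cancel₀ _ hx0.ne', waveSlope_of_ge hγ' hq1.le]
      exact hq0)
    (by simp [reflDefect_one_right])
    ⟨x, hx, neg_neg_of_pos (reflDefect_inv_pos hγ hx)⟩
  have hzp : 0 < z := by linarith
  have hpos : ∀ y, 0 < y → y < z⁻¹ → 0 < reflDefect γ x y := by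
    intro y hy hyz
    have := hz2 y⁻¹ ((lt_inv_comm₀ hy hzp).1 hyz)
    rwa [inv_inv, neg_lt_zero] at this
  have hneg : ∀ y, z⁻¹ < y → y < 1 → reflDefect γ x y < 0 := by
    intro y hyz hy
    have hy0 : 0 < y := (inv_pos.2 hzp).trans hyz
    have := hz1 y⁻¹ (one_lt_inv_iff₀.2 ⟨hy0, hy⟩) ((inv_lt_comm₀ hzp hy0).1 hyz)
    rwa [inv_inv, neg_pos] at this
  have hz0' : reflDefect γ x z⁻¹ = 0 := neg_eq_zero.1 hz0
  have hxi : x⁻¹ < 1 := inv_lt_one_of_one_lt₀ hx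
  have hxp := reflDefect_inv_pos hγ hx
  refine ⟨z⁻¹, ?_, inv_lt_one_of_one_lt₀ hz, hz0', hpos, hneg⟩
  by_contra! h
  rcases h.eq_or_lt with h | h
  · rw [← h] at hxp; linarith
  · linarith [hneg _ h hxi]

lemma continuousOn_reflDefect_left (hγ : 1 < γ) {y : ℝ} (hy : 0 < y) :
    ContinuousOn (fun x => reflDefect γ x y) (Ici 1) := by
  have h0 := aPar_pos hγ
  have hψ := continuousOn_psiB hγ
  have h1 : ContinuousOn (impRatio γ) (Ici 1) := by
    have : ContinuousOn (fun q => √(q * (1 + aPar γ * q) / (q + aPar γ))) (Ici 1) := by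
      refine ContinuousOn.sqrt (ContinuousOn.div (by fun_prop) (by fun_prop) fun q hq => ?_)
      have : (1 : ℝ) ≤ q := hq
      linarith
    exact this.congr fun q hq => impRatio_of_ge (by linarith) hq
  have h2 : ContinuousOn (fun x => psiB γ (x * y)) (Ici 1) :=
    hψ.comp (by fun_prop) fun x hx => mul_pos (zero_lt_one.trans_le hx) hy
  exact (h2.sub (hψ.mono (Ici_subset_Ioi.2 one_pos))).sub (continuousOn_const.mul h1)

/-- The zero of the reflection criterion in `(0, 1)` depends continuously on `x`, up to the
point `xBar γ` where it leaves the region. -/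
lemma exists_shock_rarefaction_curve (hγ : 5 / 3 < γ) (h2 : γ < 2) :
    ∃ h : ℝ → ℝ, ContinuousOn h (Ici (xBar γ)) ∧ h (xBar γ) = 1 ∧
      ∀ x, xBar γ < x → x⁻¹ < h x ∧ h x < 1 ∧ reflDefect γ x (h x) = 0 ∧
        (∀ y, 0 < y → y < h x → 0 < reflDefect γ x y) ∧
        ∀ y, h x < y → y < 1 → reflDefect γ x y < 0 := by
  have hγ' : 1 < γ := by linarith
  have h3 := aPar_lt_third hγ' h2
  have hxb := one_lt_xBar hγ h2
  have hiff : ∀ x, xBar γ < x ↔ 4 * aPar γ ^ 2 < (1 - 3 * aPar γ) * x := fun x => by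
    rw [xBar, div_lt_iff₀' (by linarith)]
  have hex : ∀ x, ∃ z, xBar γ < x → x⁻¹ < z ∧ z < 1 ∧ reflDefect γ x z = 0 ∧
      (∀ y, 0 < y → y < z → 0 < reflDefect γ x y) ∧
      ∀ y, z < y → y < 1 → reflDefect γ x y < 0 := by
    intro x
    by_cases hx : xBar γ < x
    · obtain ⟨z, hz⟩ := exists_shock_rarefaction_sign_change hγ (hxb.trans hx) ((hiff x).1 hx)
      exact ⟨z, fun _ => hz⟩
    · exact ⟨0, fun h => absurd h hx⟩
  choose g hg using hex
  obtain ⟨h, hh⟩ : ∃ h : ℝ → ℝ, ∀ x, h x = if x = xBar γ then 1 else g x := ⟨_, fun _ => rfl⟩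
  have hb : h (xBar γ) = 1 := by rw [hh, if_pos rfl]
  have hprop : ∀ x, xBar γ < x → x⁻¹ < h x ∧ h x < 1 ∧ reflDefect γ x (h x) = 0 ∧
      (∀ y, 0 < y → y < h x → 0 < reflDefect γ x y) ∧
      ∀ y, h x < y → y < 1 → reflDefect γ x y < 0 := by
    intro x hx
    rw [hh, if_neg hx.ne']
    exact hg x hx
  refine ⟨h, ?_, hb, hprop⟩
  -- below the curve the criterion is positive, at `x = xBar γ` too
  have hpos : ∀ x, xBar γ ≤ x → ∀ y, 0 < y → y < h x → 0 < reflDefect γ x y := by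
    intro x hx y hy hyx
    rcases hx.eq_or_lt with rfl | hx
    · rw [hb] at hyx
      exact reflDefect_pos_of_shock_rarefaction hγ hxb
        (not_lt.1 fun hc => lt_irrefl _ ((hiff _).2 hc)) hy hyx
    · exact (hprop x hx).2.2.2.1 y hy hyx
  have hle : ∀ x, xBar γ ≤ x → 0 < h x ∧ h x ≤ 1 := by
    intro x hx
    rcases hx.eq_or_lt with rfl | hx
    · rw [hb]; norm_num
    · have h0 : 0 < x⁻¹ := inv_pos.2 (by linarith)
      exact ⟨h0.trans (hprop x hx).1, (hprop x hx).2.1.le⟩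
  intro x₀ hx₀
  have hx₀' : xBar γ ≤ x₀ := hx₀
  have hcts : ∀ y, 0 < y → ContinuousWithinAt (fun x => reflDefect γ x y) (Ici (xBar γ)) x₀ :=
    fun y hy => ((continuousOn_reflDefect_left hγ' hy).mono (Ici_subset_Ici.2 hxb.le)) x₀ hx₀
  refine tendsto_order.2 ⟨fun l hl => ?_, fun u hu => ?_⟩
  · obtain ⟨y, hy1, hy2⟩ := exists_between (max_lt hl (hle x₀ hx₀').1)
    have hy0 : 0 < y := (le_max_right _ _).trans_lt hy1
    filter_upwards [(hcts y hy0).eventually_const_lt (hpos x₀ hx₀' y hy0 hy2),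
      self_mem_nhdsWithin] with x hx hxm
    refine ((le_max_left l 0).trans_lt hy1).trans_le ?_
    by_contra! hlt
    have hxm' : xBar γ ≤ x := hxm
    rcases hxm'.eq_or_lt with rfl | hxm'
    · rw [hb] at hlt
      linarith [(hle x₀ hx₀').2]
    · linarith [(hprop x hxm').2.2.2.2 y hlt (hy2.trans_le (hle x₀ hx₀').2)]
  · rcases lt_or_ge 1 u with hu1 | hu1
    · filter_upwards [self_mem_nhdsWithin] with x hxm
      exact (hle x hxm).2.trans_lt hu1
    · have hx₀b : xBar γ < x₀ := by
        refine hx₀'.lt_of_ne fun he => ?_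
        rw [← he, hb] at hu
        linarith
      obtain ⟨y, hy1, hy2⟩ := exists_between hu
      have hy0 : 0 < y := (hle x₀ hx₀').1.trans hy1
      filter_upwards [(hcts y hy0).eventually_lt_const
        ((hprop x₀ hx₀b).2.2.2.2 y hy1 (hy2.trans_le hu1)), self_mem_nhdsWithin] with x hx hxm
      refine lt_of_le_of_lt ?_ hy2
      by_contra! hlt
      linarith [hpos x hxm y hy0 hlt]

/-! ### The curve of absent transmitted waves -/

/-- The velocity defect at the pressure of the left-most state: the transmitted wave is a
rarefaction, absent or a shock according as this is positive, zero or negative. -/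
noncomputable def transDefect (γ x y : ℝ) : ℝ :=
  psiB γ (x * y)⁻¹ * (impRatio γ x * impRatio γ y) - psiB γ x - psiB γ y * impRatio γ x

lemma transDefect_neg_of_one_le (hγ : 1 < γ) {x y : ℝ} (hx : 1 < x) (hy : 1 ≤ y) :
    transDefect γ x y < 0 := by
  have h1 := psiB_pos hγ hx
  have h2 := psiB_nonneg hγ hy
  have h3 := impRatio_pos hγ (q := x) (by linarith)
  have h4 := impRatio_pos hγ (q := y) (by linarith)
  have h5 : psiB γ (x * y)⁻¹ < 0 :=
    psiB_neg hγ (by positivity) (inv_lt_one_of_one_lt₀ (by nlinarith))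
  rw [transDefect]
  have := mul_neg_of_neg_of_pos h5 (mul_pos h3 h4)
  have := mul_nonneg h2 h3.le
  linarith

/-- For `y ≤ 1` the transmission criterion is an increasing function of
`((x y)⁻¹) ^ (-ζ) (ψ((x y)⁻¹) - ν)`. -/
lemma transDefect_of_le_one (hγ : 1 < γ) {x y : ℝ} (hx : 0 < x) (hy : 0 < y) (hy1 : y ≤ 1) :
    transDefect γ x y = impRatio γ x * x ^ (-zeta γ) *
      ((x * y)⁻¹ ^ (-zeta γ) * (psiB γ (x * y)⁻¹ + -nu γ)) + nu γ * impRatio γ x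
      - psiB γ x := by
  have e : (x * y)⁻¹ ^ (-zeta γ) = x ^ zeta γ * y ^ zeta γ := by
    rw [Real.inv_rpow (mul_pos hx hy).le, Real.rpow_neg (mul_pos hx hy).le, inv_inv,
      Real.mul_rpow hx.le hy.le]
  have e2 : x ^ (-zeta γ) * x ^ zeta γ = 1 := by
    rw [← Real.rpow_add hx, neg_add_cancel, Real.rpow_zero]
  rw [transDefect, impRatio_of_le hγ hy hy1, psiB_of_le hy1, e]
  linear_combination
    -(impRatio γ x * y ^ zeta γ * (psiB γ (x * y)⁻¹ + -nu γ)) * e2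

lemma exists_transDefect_sign_change (hγ : 1 < γ) {x : ℝ} (hx : 1 < x) :
    ∃ z, 0 < z ∧ ∀ y, 0 < y → (transDefect γ x y = 0 ↔ y = z) ∧
      (transDefect γ x y < 0 ↔ z < y) := by
  have hx0 : 0 < x := by linarith
  have hs : 0 < impRatio γ x * x ^ (-zeta γ) :=
    mul_pos (impRatio_pos hγ hx0) (Real.rpow_pos_of_pos hx0 _)
  have hanti : StrictAntiOn (transDefect γ x) (Ioc 0 1) := by
    intro y hy z hz hyz
    rw [transDefect_of_le_one hγ hx0 hy.1 hy.2, transDefect_of_le_one hγ hx0 hz.1 hz.2]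
    have h1 : (x * z)⁻¹ < (x * y)⁻¹ :=
      inv_strictAnti₀ (mul_pos hx0 hy.1) (mul_lt_mul_of_pos_left hyz hx0)
    have h2 := strictMonoOn_rpow_neg_mul_psiB_sub hγ
      (inv_pos.2 (mul_pos hx0 hz.1)) (inv_pos.2 (mul_pos hx0 hy.1)) h1
    have h3 := mul_lt_mul_of_pos_left h2 hs
    simp only at h3
    linarith
  have h1 := transDefect_neg_of_one_le hγ hx le_rfl
  obtain ⟨y₁, hy₁, hy₁1, hpos⟩ : ∃ y₁, 0 < y₁ ∧ y₁ ≤ 1 ∧ 0 < transDefect γ x y₁ := by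
    obtain ⟨q, ⟨hq, hq1⟩⟩ := (((tendsto_rpow_neg_mul_psiB hγ).const_mul_atTop hs
      |>.eventually_gt_atTop (impRatio γ x * x ^ (-zeta γ) * nu γ + psiB γ x)).and
        (eventually_ge_atTop 1)).exists
    have hq0 : 0 < q := by linarith
    have hy : (x * q)⁻¹ ≤ 1 := inv_le_one_of_one_le₀ (by nlinarith)
    have e : (x * (x * q)⁻¹)⁻¹ = q := by field_simp
    refine ⟨(x * q)⁻¹, by positivity, hy, ?_⟩
    rw [transDefect_of_le_one hγ hx0 (by positivity) hy, e]
    have h2 : q ^ (-zeta γ) ≤ 1 :=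
      Real.rpow_le_one_of_one_le_of_nonpos hq1 (by linarith [zeta_pos hγ])
    have h3 := mul_le_mul_of_nonneg_right h2 (mul_pos hs (nu_pos hγ)).le
    have h4 : 0 < nu γ * impRatio γ x := mul_pos (nu_pos hγ) (impRatio_pos hγ hx0)
    linarith
  have hcont : ContinuousOn (transDefect γ x) (Icc y₁ 1) := by
    have hψ := continuousOn_psiB hγ
    have h2 : ContinuousOn (fun y : ℝ => (x * y)⁻¹) (Icc y₁ 1) :=
      ContinuousOn.inv₀ (by fun_prop) fun y hy => (mul_pos hx0 (hy₁.trans_le hy.1)).ne'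
    have h3 : ContinuousOn (fun y : ℝ => psiB γ (x * y)⁻¹) (Icc y₁ 1) :=
      hψ.comp h2 fun y hy => inv_pos.2 (mul_pos hx0 (hy₁.trans_le hy.1))
    have h4 : ContinuousOn (fun y : ℝ => (x * y)⁻¹ ^ (-zeta γ)) (Icc y₁ 1) :=
      h2.rpow_const fun y hy => Or.inl (inv_pos.2 (mul_pos hx0 (hy₁.trans_le hy.1))).ne'
    have h5 := (((continuousOn_const (c := impRatio γ x * x ^ (-zeta γ))).mul
      (h4.mul (h3.add (continuousOn_const (c := -nu γ))))).add
        (continuousOn_const (c := nu γ * impRatio γ x))).sub (continuousOn_const (c := psiB γ x))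
    exact h5.congr fun y hy => transDefect_of_le_one hγ hx0 (hy₁.trans_le hy.1) hy.2
  obtain ⟨z, hz, hz0⟩ := intermediate_value_Icc' hy₁1 hcont ⟨h1.le, hpos.le⟩
  have hzp : 0 < z := hy₁.trans_le hz.1
  have hneg : ∀ y, z < y → transDefect γ x y < 0 := by
    intro y hy
    rcases le_total y 1 with h | h
    · exact (hanti ⟨hzp, hz.2⟩ ⟨hzp.trans hy, h⟩ hy).trans_eq hz0
    · exact transDefect_neg_of_one_le hγ hx h
  have hgt : ∀ y, 0 < y → y < z → 0 < transDefect γ x y := fun y hy hyz =>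
    hz0.symm.trans_lt (hanti ⟨hy, hyz.le.trans hz.2⟩ ⟨hzp, hz.2⟩ hyz)
  refine ⟨z, hzp, fun y hy => ?_⟩
  rcases lt_trichotomy y z with h | rfl | h
  · have := hgt y hy h
    exact ⟨⟨fun h' => by linarith, fun h' => by linarith⟩,
      ⟨fun h' => by linarith, fun h' => by linarith⟩⟩
  · exact ⟨⟨fun _ => rfl, fun _ => hz0⟩, ⟨fun h' => by linarith, fun h' => by linarith⟩⟩
  · have := hneg y h
    exact ⟨⟨fun h' => by linarith, fun h' => by linarith⟩, ⟨fun _ => h, fun _ => this⟩⟩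

/-! ### The Riemann problem -/

lemma phiF_inv (hγ : 1 < γ) {f : ℝ} (hf : 0 < f) : phiF γ f = (phiB γ f⁻¹)⁻¹ := by
  have h0 := aPar_pos hγ
  rcases le_or_gt 1 f with h | h
  · rw [phiF, if_pos h, phiB, if_pos (inv_le_one_of_one_le₀ h), Real.inv_rpow hf.le, inv_inv]
  · rw [phiF, if_neg h.not_ge, phiB, if_neg (one_lt_inv_iff₀.2 ⟨hf, h⟩).not_ge]
    field_simp

lemma phiF_pos (hγ : 1 < γ) {f : ℝ} (hf : 0 < f) : 0 < phiF γ f := by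
  rw [phiF_inv hγ hf]
  exact inv_pos.2 (phiB_pos hγ (inv_pos.2 hf))

/-- A forward wave of strength `f` is a backward wave of strength `f⁻¹` read from right to
left. -/
lemma psiF_eq (hγ : 1 < γ) {f : ℝ} (hf : 0 < f) :
    psiF γ f = -psiB γ f⁻¹ * √(f * phiF γ f) := by
  have hs := (impRatio_pos hγ (inv_pos.2 hf)).ne'
  have e : √(f * phiF γ f) = (impRatio γ f⁻¹)⁻¹ := by
    rw [phiF_inv hγ hf, impRatio, ← Real.sqrt_inv, mul_inv, inv_inv]
  rw [e, eq_mul_inv_iff_mul_eq₀ hs]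
  rcases le_or_gt 1 f with h | h
  · have h1 := inv_le_one_of_one_le₀ h
    have h2 : f ^ zeta γ ≠ 0 := (Real.rpow_pos_of_pos hf _).ne'
    rw [psiF_of_ge h, psiB_of_le h1, impRatio_of_le hγ (inv_pos.2 hf) h1, Real.inv_rpow hf.le]
    field_simp
    ring
  · have := shockPsi_inv_mul_impRatio hγ (one_lt_inv_iff₀.2 ⟨hf, h⟩).le
    rwa [inv_inv, ← psiF_of_le h.le] at this

lemma nu_eq (hγ : 1 < γ) : nu γ = 2 / (γ - 1) * √γ := by
  have h0 := aPar_pos hγ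
  have h1 : 0 < γ + 1 := by linarith
  have h2 : 0 < γ - 1 := by linarith
  have e : √(1 - aPar γ ^ 2) = 2 / (γ + 1) * √γ := by
    have h3 := aPar_lt_one hγ
    rw [Real.sqrt_eq_iff_mul_self_eq (by nlinarith) (by positivity), mul_mul_mul_comm,
      Real.mul_self_sqrt (by linarith), aPar]
    field_simp
    ring
  rw [nu, e, aPar]
  field_simp

/-- The velocity defect of the Riemann problem `(l, r)` when the outgoing backward wave has
strength `B` and the outgoing forward wave connects the resulting pressure to that of `r`. -/
noncomputable def riemannDefect (γ : ℝ) (l r : GasState) (B : ℝ) : ℝ :=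
  psiB γ B * √(l.τ * l.p) + psiB γ (B * l.p / r.p) * √(r.τ * r.p) + (r.u - l.u)

lemma GasState.eq_iff {s t : GasState} : s = t ↔ s.τ = t.τ ∧ s.u = t.u ∧ s.p = t.p := by
  cases s; cases t; simp

lemma solvesRiemann_iff (hγ : 1 < γ) {l r : GasState} (hl : l.Physical) (hr : r.Physical)
    {B C F : ℝ} : SolvesRiemann γ l r B C F ↔ 0 < B ∧ F = r.p / (B * l.p) ∧
      C = r.τ / (phiF γ F * phiB γ B * l.τ) ∧ riemannDefect γ l r B = 0 := by
  obtain ⟨hlτ, hlp⟩ := hl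
  obtain ⟨hrτ, hrp⟩ := hr
  rw [SolvesRiemann, GasState.eq_iff]
  simp only [forwardWave, contactWave, backwardWave]
  -- once pressure and specific volume agree, so does the velocity defect
  have key : 0 < B → 0 < C → 0 < F → F * (B * l.p) = r.p →
      phiF γ F * (C * (phiB γ B * l.τ)) = r.τ →
      l.u - psiB γ B * √(l.τ * l.p) + psiF γ F * √(C * (phiB γ B * l.τ) * (B * l.p)) =
        r.u - riemannDefect γ l r B := by
    intro hB hC hF hp hτ
    have h1 : √(r.τ * r.p) = √(F * phiF γ F) * √(C * (phiB γ B * l.τ) * (B * l.p)) := by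
      rw [← Real.sqrt_mul (mul_pos hF (phiF_pos hγ hF)).le, ← hp, ← hτ]
      congr 1; ring
    have h2 : F⁻¹ = B * l.p / r.p := by rw [← hp]; field_simp
    rw [psiF_eq hγ hF, riemannDefect, h1, ← h2]
    ring
  constructor
  · rintro ⟨hB, hC, hF, hτ, hu, hp⟩
    have hφ := phiF_pos hγ hF
    have hφ' := phiB_pos hγ hB
    refine ⟨hB, ?_, ?_, ?_⟩
    · rw [eq_div_iff (by positivity)]; exact hp
    · rw [eq_div_iff (by positivity), ← hτ]; ring
    · rw [key hB hC hF hp hτ] at hu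
      linarith
  · rintro ⟨hB, hF, hC, h⟩
    have hF0 : 0 < F := by rw [hF]; positivity
    have hφ := phiF_pos hγ hF0
    have hφ' := phiB_pos hγ hB
    have hC0 : 0 < C := by rw [hC]; positivity
    have hp : F * (B * l.p) = r.p := by rw [hF]; field_simp
    have hτ : phiF γ F * (C * (phiB γ B * l.τ)) = r.τ := by rw [hC]; field_simp
    refine ⟨hB, hC0, hF0, hτ, ?_, hp⟩
    rw [key hB hC0 hF0 hp hτ, h, sub_zero]

lemma hasVacuum_iff (hγ : 1 < γ) {l r : GasState} :
    HasVacuum γ l r ↔ nu γ * (√(r.τ * r.p) + √(l.τ * l.p)) ≤ r.u - l.u := by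
  have h0 : (0 : ℝ) ≤ γ := by linarith
  rw [HasVacuum, soundSpeed, soundSpeed, nu_eq hγ, mul_assoc γ, mul_assoc γ,
    Real.sqrt_mul h0, Real.sqrt_mul h0, ← mul_add, ← mul_assoc]

lemma sqrt_mul_pos {s : GasState} (hs : s.Physical) : 0 < √(s.τ * s.p) :=
  Real.sqrt_pos.2 (mul_pos hs.1 hs.2)

lemma strictMonoOn_riemannDefect (hγ : 1 < γ) {l r : GasState} (hl : l.Physical)
    (hr : r.Physical) : StrictMonoOn (riemannDefect γ l r) (Ioi 0) := by
  intro B hB B' hB' h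
  have hB : 0 < B := hB
  have hB' : 0 < B' := hB'
  have hlp := hl.2
  have hrp := hr.2
  have h1 := mul_lt_mul_of_pos_right (strictMonoOn_psiB hγ hB hB' h) (sqrt_mul_pos hl)
  have h2 : B * l.p / r.p < B' * l.p / r.p := by gcongr
  have h3 := mul_lt_mul_of_pos_right (strictMonoOn_psiB hγ (show 0 < B * l.p / r.p by positivity)
    (show 0 < B' * l.p / r.p by positivity) h2) (sqrt_mul_pos hr)
  rw [riemannDefect, riemannDefect]
  linarith

lemma riemannDefect_pos_of_hasVacuum (hγ : 1 < γ) {l r : GasState} (hl : l.Physical)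
    (hr : r.Physical) (h : HasVacuum γ l r) {B : ℝ} (hB : 0 < B) :
    0 < riemannDefect γ l r B := by
  rw [hasVacuum_iff hγ] at h
  have h1 := mul_lt_mul_of_pos_right (neg_nu_lt_psiB hγ hB) (sqrt_mul_pos hl)
  have h2 := mul_lt_mul_of_pos_right (neg_nu_lt_psiB hγ
    (div_pos (mul_pos hB hl.2) hr.2)) (sqrt_mul_pos hr)
  rw [riemannDefect]
  linarith

lemma exists_riemannDefect_eq_zero (hγ : 1 < γ) {l r : GasState} (hl : l.Physical)
    (hr : r.Physical) (h : ¬HasVacuum γ l r) : ∃ B, 0 < B ∧ riemannDefect γ l r B = 0 := by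
  rw [hasVacuum_iff hγ, not_le] at h
  have hlp := hl.2
  have hrp := hr.2
  have hc : 0 < l.p / r.p := div_pos hlp hrp
  have hψ := continuousOn_psiB hγ
  have hcont : ContinuousOn (riemannDefect γ l r) (Ioi 0) := by
    have h1 : ContinuousOn (fun B => psiB γ (B * l.p / r.p)) (Ioi 0) :=
      hψ.comp (by fun_prop) fun B hB => div_pos (mul_pos hB hlp) hrp
    exact ((hψ.mul continuousOn_const).add (h1.mul continuousOn_const)).add continuousOn_const
  have hzero : Tendsto (riemannDefect γ l r) (𝓝[>] 0)
      (𝓝 (-nu γ * √(l.τ * l.p) + -nu γ * √(r.τ * r.p) + (r.u - l.u))) := by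
    have h1 : Tendsto (fun B : ℝ => B * l.p / r.p) (𝓝[>] 0) (𝓝[>] 0) := by
      refine tendsto_nhdsWithin_iff.2 ⟨?_, ?_⟩
      · have : ContinuousAt (fun B : ℝ => B * l.p / r.p) 0 := by fun_prop
        have h2 := this.tendsto
        rw [zero_mul, zero_div] at h2
        exact h2.mono_left nhdsWithin_le_nhds
      · filter_upwards [self_mem_nhdsWithin] with B hB
        exact div_pos (mul_pos hB hlp) hrp
    exact (((tendsto_psiB_zero hγ).mul_const _).add
      (((tendsto_psiB_zero hγ).comp h1).mul_const _)).add_const _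
  have htop : Tendsto (riemannDefect γ l r) atTop atTop := by
    have h1 : Tendsto (fun B : ℝ => B * l.p / r.p) atTop atTop :=
      (tendsto_id.atTop_mul_const hlp).atTop_div_const hrp
    exact tendsto_atTop_add_const_right _ _
      (((tendsto_psiB_atTop hγ).atTop_mul_const (sqrt_mul_pos hl)).atTop_add_atTop
        (((tendsto_psiB_atTop hγ).comp h1).atTop_mul_const (sqrt_mul_pos hr)))
  obtain ⟨B₁, hB₁, hB₁0⟩ := ((hzero.eventually_lt_const
    (show -nu γ * √(l.τ * l.p) + -nu γ * √(r.τ * r.p) + (r.u - l.u) < 0 by linarith)).and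
      self_mem_nhdsWithin).exists
  obtain ⟨B₂, hB₂, hB₂1⟩ := ((htop.eventually_gt_atTop 0).and (eventually_ge_atTop B₁)).exists
  obtain ⟨B, hB, hB0⟩ := intermediate_value_Icc hB₂1
    (hcont.mono fun t ht => (show 0 < B₁ from hB₁0).trans_le ht.1) ⟨hB₁.le, hB₂.le⟩
  exact ⟨B, (show 0 < B₁ from hB₁0).trans_le hB.1, hB0⟩

lemma isOutgoing_iff (hγ : 1 < γ) {l r : GasState} (hl : l.Physical) (hr : r.Physical)
    {P : EReal × EReal} : IsOutgoing γ l r P ↔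
      (∃ B : ℝ, 0 < B ∧ riemannDefect γ l r B = 0 ∧
        P = ((B : EReal), ((r.p / (B * l.p) : ℝ) : EReal))) ∨
      (HasVacuum γ l r ∧ P = (0, ⊤)) := by
  rw [IsOutgoing]
  refine or_congr_left ⟨?_, ?_⟩
  · rintro ⟨B, C, F, h, hP⟩
    obtain ⟨hB, hF, -, h0⟩ := (solvesRiemann_iff hγ hl hr).1 h
    exact ⟨B, hB, h0, hF ▸ hP⟩
  · rintro ⟨B, hB, h0, hP⟩
    exact ⟨B, _, _, (solvesRiemann_iff hγ hl hr).2 ⟨hB, rfl, rfl, h0⟩, hP⟩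

/-- The Riemann problem is uniquely solvable, possibly with a vacuum. -/
lemma existsUnique_isOutgoing (hγ : 1 < γ) {l r : GasState} (hl : l.Physical)
    (hr : r.Physical) : ∃! P : EReal × EReal, IsOutgoing γ l r P := by
  simp only [isOutgoing_iff hγ hl hr]
  by_cases hv : HasVacuum γ l r
  · refine ⟨(0, ⊤), Or.inr ⟨hv, rfl⟩, ?_⟩
    rintro P (⟨B, hB, h0, -⟩ | ⟨-, hP⟩)
    · exact absurd h0 (riemannDefect_pos_of_hasVacuum hγ hl hr hv hB).ne'
    · exact hP
  · obtain ⟨B, hB, h0⟩ := exists_riemannDefect_eq_zero hγ hl hr hv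
    refine ⟨_, Or.inl ⟨B, hB, h0, rfl⟩, ?_⟩
    rintro P (⟨B', hB', h0', hP⟩ | ⟨hv', -⟩)
    · rw [hP, (strictMonoOn_riemannDefect hγ hl hr).injOn hB' hB (h0'.trans h0.symm)]
    · exact absurd hv' hv

lemma IsOutgoing.fst_eq_one_iff (hγ : 1 < γ) {l r : GasState} (hl : l.Physical)
    (hr : r.Physical) {P : EReal × EReal} (hP : IsOutgoing γ l r P) :
    P.1 = 1 ↔ riemannDefect γ l r 1 = 0 := by
  rcases (isOutgoing_iff hγ hl hr).1 hP with ⟨B, hB, h0, rfl⟩ | ⟨hv, rfl⟩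
  · rw [← h0, (strictMonoOn_riemannDefect hγ hl hr).injOn.eq_iff (mem_Ioi.2 one_pos)
      (mem_Ioi.2 hB), ← EReal.coe_one, EReal.coe_eq_coe_iff, eq_comm]
  · exact iff_of_false (by simp) (riemannDefect_pos_of_hasVacuum hγ hl hr hv one_pos).ne'

/-- The sign of the defect at the backward strength `r.p / l.p`, for which there is no forward
wave, decides the type of the forward wave. -/
lemma IsOutgoing.snd_compare_one (hγ : 1 < γ) {l r : GasState} (hl : l.Physical)
    (hr : r.Physical) {P : EReal × EReal} (hP : IsOutgoing γ l r P) :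
    (P.2 = 1 ↔ riemannDefect γ l r (r.p / l.p) = 0) ∧
    (1 < P.2 ↔ 0 < riemannDefect γ l r (r.p / l.p)) ∧
    (P.2 < 1 ↔ riemannDefect γ l r (r.p / l.p) < 0) := by
  have hlp := hl.2
  have hrp := hr.2
  have hq : 0 < r.p / l.p := div_pos hrp hlp
  rcases (isOutgoing_iff hγ hl hr).1 hP with ⟨B, hB, h0, rfl⟩ | ⟨hv, rfl⟩
  · have hm := strictMonoOn_riemannDefect hγ hl hr
    have hBp : 0 < B * l.p := mul_pos hB hlp
    rw [← h0, hm.injOn.eq_iff (mem_Ioi.2 hq) (mem_Ioi.2 hB), hm.lt_iff_lt (mem_Ioi.2 hB)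
      (mem_Ioi.2 hq), hm.lt_iff_lt (mem_Ioi.2 hq) (mem_Ioi.2 hB)]
    simp only [← EReal.coe_one, EReal.coe_eq_coe_iff, EReal.coe_lt_coe_iff]
    rw [div_eq_one_iff_eq hBp.ne', one_lt_div hBp, div_lt_one hBp, div_eq_iff hlp.ne',
      lt_div_iff₀ hlp, div_lt_iff₀ hlp]
    exact ⟨Iff.rfl, Iff.rfl, Iff.rfl⟩
  · have h := riemannDefect_pos_of_hasVacuum hγ hl hr hv hq
    refine ⟨iff_of_false (EReal.coe_ne_top 1).symm h.ne', iff_of_true (EReal.coe_lt_top 1) h,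
      iff_of_false not_top_lt h.not_gt⟩

/-! ### The interaction of two backward waves -/

lemma physical_overtakingRight (hγ : 1 < γ) {l : GasState} (hl : l.Physical) {x y : ℝ}
    (hx : 0 < x) (hy : 0 < y) : (overtakingRight γ x y l).Physical :=
  ⟨mul_pos (phiB_pos hγ hy) (mul_pos (phiB_pos hγ hx) hl.1), mul_pos hy (mul_pos hx hl.2)⟩

lemma riemannDefect_overtakingRight (hγ : 1 < γ) {l : GasState} (hl : l.Physical) {x y : ℝ}
    (hx : 0 < x) (hy : 0 < y) (B : ℝ) :
    riemannDefect γ l (overtakingRight γ x y l) B = √(l.τ * l.p) *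
      (psiB γ B + psiB γ (B / (x * y)) * (impRatio γ x * impRatio γ y) -
        psiB γ x - psiB γ y * impRatio γ x) := by
  have hlp := hl.2
  have hφx := phiB_pos hγ hx
  have hφy := phiB_pos hγ hy
  have e1 : √(phiB γ x * l.τ * (x * l.p)) = impRatio γ x * √(l.τ * l.p) := by
    rw [impRatio, ← Real.sqrt_mul (by positivity)]
    congr 1; ring
  have e2 : √(phiB γ y * (phiB γ x * l.τ) * (y * (x * l.p))) =
      impRatio γ x * impRatio γ y * √(l.τ * l.p) := by
    rw [impRatio, impRatio, ← Real.sqrt_mul (by positivity), ← Real.sqrt_mul (by positivity)]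
    congr 1; ring
  have e3 : B * l.p / (y * (x * l.p)) = B / (x * y) := by field_simp
  simp only [riemannDefect, overtakingRight, backwardWave]
  rw [e1, e2, e3]
  ring

lemma isOutgoing_outgoingPair (hγ : 1 < γ) {l : GasState} (hl : l.Physical) {x y : ℝ}
    (hx : 0 < x) (hy : 0 < y) :
    IsOutgoing γ l (overtakingRight γ x y l) (outgoingPair γ l x y) :=
  Classical.epsilon_spec
    (existsUnique_isOutgoing hγ hl (physical_overtakingRight hγ hl hx hy)).exists

lemma reflected_compare_one (hγ : 1 < γ) {l : GasState} (hl : l.Physical) {x y : ℝ}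
    (hx : 0 < x) (hy : 0 < y) :
    (reflected γ l x y = 1 ↔ reflDefect γ x y = 0) ∧
    (1 < reflected γ l x y ↔ 0 < reflDefect γ x y) ∧
    (reflected γ l x y < 1 ↔ reflDefect γ x y < 0) := by
  have hlp := hl.2
  have hN := sqrt_mul_pos hl
  have h := (isOutgoing_outgoingPair hγ hl hx hy).snd_compare_one hγ hl
    (physical_overtakingRight hγ hl hx hy)
  have e : (overtakingRight γ x y l).p / l.p = x * y := by
    simp only [overtakingRight, backwardWave]
    field_simp
  have e2 : riemannDefect γ l (overtakingRight γ x y l) (x * y) =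
      √(l.τ * l.p) * reflDefect γ x y := by
    rw [riemannDefect_overtakingRight hγ hl hx hy, div_self (mul_pos hx hy).ne', psiB_one,
      reflDefect]
    ring
  have e3 : √(l.τ * l.p) * reflDefect γ x y < 0 ↔ reflDefect γ x y < 0 := by
    rw [← neg_pos, ← mul_neg, mul_pos_iff_of_pos_left hN, neg_pos]
  rwa [e, e2, mul_eq_zero_iff_left hN.ne', mul_pos_iff_of_pos_left hN, e3] at h

lemma transmitted_eq_one_iff (hγ : 1 < γ) {l : GasState} (hl : l.Physical) {x y : ℝ}
    (hx : 0 < x) (hy : 0 < y) : transmitted γ l x y = 1 ↔ transDefect γ x y = 0 := by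
  have h := (isOutgoing_outgoingPair hγ hl hx hy).fst_eq_one_iff hγ hl
    (physical_overtakingRight hγ hl hx hy)
  have e2 : riemannDefect γ l (overtakingRight γ x y l) 1 =
      √(l.τ * l.p) * transDefect γ x y := by
    rw [riemannDefect_overtakingRight hγ hl hx hy, psiB_one, one_div, transDefect]
    ring
  rwa [e2, mul_eq_zero_iff_left (sqrt_mul_pos hl).ne'] at h

end GasDynamics

theorem mainTheorem2 (γ : ℝ) (hγ : 5 / 3 < γ) :
    -- the outgoing strengths are well defined for all incoming strengths
    (∀ l : GasState, l.Physical → ∀ x y : ℝ, 0 < x → 0 < y →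
      ∃! P : EReal × EReal, IsOutgoing γ l (overtakingRight γ x y l) P) ∧
    -- two shocks
    ((StrictAntiOn (jCurve γ) (Ici 1) ∧
      (1 < yBar γ ∧ jCurve γ 1 = yBar γ) ∧
      (γ < 2 → 1 < xBar γ ∧ jCurve γ (xBar γ) = 1) ∧
      (2 ≤ γ → Tendsto (jCurve γ) atTop (𝓝 (yStar γ))) ∧
      (γ = 2 → yStar γ = 1) ∧ (2 < γ → 1 < yStar γ)) ∧
     (∀ l : GasState, l.Physical →
      (∀ x y : ℝ, 1 < x → 1 < y →
        (reflected γ l x y = 1 ↔ y = jCurve γ x) ∧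
        (1 < reflected γ l x y ↔ max (jCurve γ x) 1 < y) ∧
        (reflected γ l x y < 1 ↔ 1 < y ∧ y < jCurve γ x)) ∧
      (∃ x y : ℝ, 1 < x ∧ 1 < y ∧ 1 < reflected γ l x y) ∧
      (∃ x y : ℝ, 1 < x ∧ 1 < y ∧ reflected γ l x y < 1))) ∧
    -- shock followed by rarefaction
    ((2 ≤ γ → ∀ l : GasState, l.Physical → ∀ x y : ℝ, 1 < x → 0 < y → y < 1 →
        reflected γ l x y ≠ 1 ∧ 1 < reflected γ l x y) ∧
     (γ < 2 → ∃ h k : ℝ → ℝ,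
        ContinuousOn h (Ici (xBar γ)) ∧ h (xBar γ) = 1 ∧
        (∀ x : ℝ, xBar γ < x → 0 < h x ∧ h x < 1) ∧
        (∀ x : ℝ, xBar γ < x → k x < h x) ∧
        (∀ x : ℝ, 1 < x → 0 < k x) ∧
        (∀ l : GasState, l.Physical →
          (∀ x y : ℝ, 1 < x → 0 < y → (transmitted γ l x y = 1 ↔ y = k x)) ∧
          (∀ x y : ℝ, 1 < x → 0 < y → y < 1 →
            (reflected γ l x y = 1 ↔ xBar γ < x ∧ y = h x) ∧
            (1 < reflected γ l x y ↔ x ≤ xBar γ ∨ y < h x) ∧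
            (reflected γ l x y < 1 ↔ xBar γ < x ∧ h x < y))))) ∧
    -- rarefaction followed by shock
    (∃ (y₀ : ℝ) (i : ℝ → ℝ),
      (1 < y₀ ∧ ∀ q : ℝ, 0 < q → q ≠ 1 → (alpha γ q = 0 ↔ q = y₀)) ∧
      (∀ x : ℝ, 0 < x → x < 1 → 1 < i x) ∧
      (∀ x : ℝ, 0 < x → x < 1 / y₀ → i x = y₀) ∧
      (∀ x : ℝ, 1 / y₀ < x → x < 1 → 1 / x < i x ∧ i x < min (yBar γ / x) y₀) ∧
      (∀ l : GasState, l.Physical → ∀ x y : ℝ, 0 < x → x < 1 → 1 < y →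
        (reflected γ l x y = 1 ↔ y = i x) ∧
        (1 < reflected γ l x y ↔ y < i x) ∧
        (reflected γ l x y < 1 ↔ i x < y))) := by
  have hγ' : 1 < γ := by linarith
  refine ⟨fun l hl x y hx hy =>
    existsUnique_isOutgoing hγ' hl (physical_overtakingRight hγ' hl hx hy), ?_, ?_, ?_⟩
  · have hj : ∀ l : GasState, l.Physical → ∀ x y : ℝ, 1 < x → 1 < y →
        (reflected γ l x y = 1 ↔ y = jCurve γ x) ∧
        (1 < reflected γ l x y ↔ jCurve γ x < y) ∧
        (reflected γ l x y < 1 ↔ y < jCurve γ x) := by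
      intro l hl x y hx hy
      obtain ⟨h1, h2, h3⟩ := reflected_compare_one hγ' hl (x := x) (y := y)
        (by linarith) (by linarith)
      obtain ⟨c, hc, he⟩ := exists_reflDefect_eq_mul_sub_jCurve hγ' hx hy
      rw [h1, h2, h3, he]
      refine ⟨?_, ?_, ?_⟩
      · rw [mul_eq_zero_iff_left hc.ne', sub_eq_zero]
      · rw [mul_pos_iff_of_pos_left hc, sub_pos]
      · rw [← neg_pos, ← mul_neg, mul_pos_iff_of_pos_left hc, neg_pos, sub_neg]
    have hyb : 1 < yBar γ := (strictMonoOn_rpow_neg_mul_psiB_add hγ).1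
    refine ⟨⟨(strictAntiOn_jCurve hγ').mono (Ici_subset_Ioi.2 one_pos), ⟨hyb, jCurve_one hγ'⟩,
      fun h => ⟨one_lt_xBar hγ h, jCurve_xBar hγ h⟩, fun _ => tendsto_jCurve_atTop hγ',
      fun h => h ▸ yStar_two, one_lt_yStar⟩, fun l hl => ⟨fun x y hx hy => ?_, ?_, ?_⟩⟩
    · obtain ⟨h1, h2, h3⟩ := hj l hl x y hx hy
      refine ⟨h1, ?_, ?_⟩
      · rw [h2, max_lt_iff, and_iff_left hy]
      · rw [h3, and_iff_right hy]
    · have hy : 1 < max (jCurve γ 2) 1 + 1 := by linarith [le_max_right (jCurve γ 2) 1]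
      refine ⟨2, _, one_lt_two, hy, (hj l hl 2 _ one_lt_two hy).2.1.2 ?_⟩
      linarith [le_max_left (jCurve γ 2) 1]
    · have h1 : 1 < jCurve γ 1 := by rw [jCurve_one hγ']; exact hyb
      obtain ⟨x, hx1, hx⟩ := ((((continuousAt_jCurve hγ' one_pos).eventually_const_lt
        h1).filter_mono (nhdsWithin_le_nhds (s := Ioi 1))).and self_mem_nhdsWithin).exists
      obtain ⟨y, hy1, hy2⟩ := exists_between hx1
      exact ⟨x, y, hx, hy1, (hj l hl x y hx hy1).2.2.2 hy2⟩
  · refine ⟨fun h l hl x y hx hy hy1 => ?_, fun h2 => ?_⟩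
    · have h3 := third_le_aPar h
      have hpos := reflDefect_pos_of_shock_rarefaction hγ hx
        (by nlinarith [sq_nonneg (aPar γ)]) hy hy1
      obtain ⟨-, hr, -⟩ := reflected_compare_one hγ' hl (x := x) (y := y) (by linarith) hy
      exact ⟨(hr.2 hpos).ne', hr.2 hpos⟩
    · obtain ⟨h, hcont, hb, hh⟩ := exists_shock_rarefaction_curve hγ h2
      have hxb := one_lt_xBar hγ h2
      have h3 := aPar_lt_third hγ' h2
      have hkex : ∀ x, ∃ z, 1 < x → 0 < z ∧ ∀ y, 0 < y → (transDefect γ x y = 0 ↔ y = z) ∧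
          (transDefect γ x y < 0 ↔ z < y) := by
        intro x
        by_cases hx : 1 < x
        · obtain ⟨z, hz⟩ := exists_transDefect_sign_change hγ' hx
          exact ⟨z, fun _ => hz⟩
        · exact ⟨0, fun h' => absurd h' hx⟩
      choose k hk using hkex
      have hpos : ∀ x, xBar γ < x → 0 < h x := fun x hx =>
        (inv_pos.2 (by linarith : 0 < x)).trans (hh x hx).1
      refine ⟨h, k, hcont, hb, fun x hx => ⟨hpos x hx, (hh x hx).2.1⟩, fun x hx => ?_,
        fun x hx => (hk x hx).1, fun l hl => ⟨fun x y hx hy => ?_, fun x y hx hy hy1 => ?_⟩⟩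
      · -- without a reflected wave the transmitted strength is `x * h x`, which exceeds `1`
        obtain ⟨h4, -, h5, -, -⟩ := hh x hx
        have hx1 : 1 < x := hxb.trans hx
        have hx0 : 0 < x := by linarith
        have hh0 := hpos x hx
        refine ((hk x hx1).2 _ hh0).2.1 ?_
        have h6 : 1 < x * h x := by
          rwa [inv_lt_iff_one_lt_mul₀' hx0] at h4
        have h7 := psiB_pos hγ' h6
        have h8 := mul_neg_of_neg_of_pos
          (psiB_neg hγ' (inv_pos.2 (mul_pos hx0 hh0)) (inv_lt_one_of_one_lt₀ h6))
          (mul_pos (impRatio_pos hγ' hx0) (impRatio_pos hγ' hh0))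
        rw [reflDefect] at h5
        rw [transDefect]
        linarith
      · rw [transmitted_eq_one_iff hγ' hl (by linarith) hy]
        exact ((hk x hx).2 y hy).1
      · obtain ⟨h4, h5, h6⟩ := reflected_compare_one hγ' hl (x := x) (y := y) (by linarith) hy
        rw [h4, h5, h6]
        rcases le_or_gt x (xBar γ) with hxx | hxx
        · have h7 := reflDefect_pos_of_shock_rarefaction hγ hx
            (by rwa [xBar, le_div_iff₀' (by linarith)] at hxx) hy hy1
          exact ⟨iff_of_false h7.ne' fun hc => hxx.not_gt hc.1, iff_of_true h7 (Or.inl hxx),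
            iff_of_false h7.not_gt fun hc => hxx.not_gt hc.1⟩
        · obtain ⟨-, -, h7, h8, h9⟩ := hh x hxx
          rw [and_iff_right hxx, and_iff_right hxx, or_iff_right hxx.not_ge]
          exact sign_change_iff h7 (h8 y hy) fun hc => h9 y hc hy1
  · obtain ⟨y₀, hy₀, hα, hαp, hαn⟩ := exists_alpha_sign_change hγ
    have hy₀p : 0 < y₀ := by linarith
    have hiex : ∀ x, ∃ z, 0 < x → x < 1 → 1 < z ∧ reflDefect γ x z = 0 ∧
        (∀ y, 1 < y → y < z → 0 < reflDefect γ x y) ∧ ∀ y, z < y → reflDefect γ x y < 0 := by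
      intro x
      by_cases hx : 0 < x ∧ x < 1
      · obtain ⟨z, hz⟩ := exists_rarefaction_shock_sign_change hγ hx.1 hx.2
        exact ⟨z, fun _ _ => hz⟩
      · exact ⟨0, fun h h' => absurd ⟨h, h'⟩ hx⟩
    choose i hi using hiex
    have hcmp : ∀ x y, 0 < x → x < 1 → 1 < y → (reflDefect γ x y = 0 ↔ y = i x) ∧
        (0 < reflDefect γ x y ↔ y < i x) ∧ (reflDefect γ x y < 0 ↔ i x < y) := by
      intro x y hx hx1 hy
      obtain ⟨-, h1, h2, h3⟩ := hi x hx hx1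
      exact sign_change_iff h1 (h2 y hy) (h3 y)
    refine ⟨y₀, i, ⟨hy₀, fun q hq hq1 => ⟨fun h => ?_, fun h => h ▸ hα⟩⟩,
      fun x hx hx1 => (hi x hx hx1).1, fun x hx hxy => ?_, fun x hxy hx1 => ?_,
      fun l hl x y hx hx1 hy => ?_⟩
    · rcases hq1.lt_or_gt with hq1 | hq1
      · exact absurd h (alpha_pos_of_lt_one hγ hq hq1).ne'
      · rcases lt_trichotomy q y₀ with h' | h' | h'
        · exact absurd h (hαp q hq1 h').ne'
        · exact h'
        · exact absurd h (hαn q h').ne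
    · have hx1 : x < 1 := hxy.trans ((div_lt_one hy₀p).2 hy₀)
      refine (((hcmp x y₀ hx hx1 hy₀).1).1 ?_).symm
      rw [reflDefect_of_mul_le_one hγ' hx hx1.le hy₀.le ((lt_div_iff₀ hy₀p).1 hxy).le, hα,
        mul_zero]
    · have hx : 0 < x := (one_div_pos.2 hy₀p).trans hxy
      have hxy' : 1 < x * y₀ := (div_lt_iff₀ hy₀p).1 hxy
      have hx' : 1 < 1 / x := (one_lt_div hx).2 hx1
      refine ⟨((hcmp x _ hx hx1 hx').2.1).1 ?_, lt_min ?_ ?_⟩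
      · rw [reflDefect_of_mul_le_one hγ' hx hx1.le hx'.le (mul_one_div_cancel hx.ne').le]
        refine mul_pos (Real.rpow_pos_of_pos hx _) (hαp _ hx' ?_)
        rwa [div_lt_iff₀' hx]
      · have hyb : 1 < yBar γ := (strictMonoOn_rpow_neg_mul_psiB_add hγ).1
        have : 1 < yBar γ / x := by rw [one_lt_div hx]; linarith
        exact ((hcmp x _ hx hx1 this).2.2).1 (reflDefect_yBar_div_neg hγ hx hx1)
      · refine ((hcmp x _ hx hx1 hy₀).2.2).1 ?_
        rw [reflDefect_of_alpha_eq_zero hγ' hx hx1.le hy₀.le hxy'.le hα, neg_lt_zero]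
        exact hαp _ hxy' (by nlinarith)
    · obtain ⟨h1, h2, h3⟩ := reflected_compare_one hγ' hl hx (show 0 < y by linarith)
      rw [h1, h2, h3]
      exact hcmp x y hx hx1 hy
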